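/- Let $d\ge 3$ and let $\mathcal D^{1,2}(\mathbb R^d)$ be the completion of $C_c^\infty(\mathbb R^d)$ (real-valued functions) under the norm $\|\nabla u\|_{L^2(\mathbb R^d)}$, realized as a space of functions in $L^{2d/(d-2)}(\mathbb R^d)$. Put \[ \mathsf C^*_{\rm LH}:=\frac 4d\,\frac{\Gamma(d/2)^{2/d}}{\pi\,(8\pi e)^{1/d}}\left[\frac{d-1}{(d-2)^2}\right]^{1-\frac 1d}. \] If $u\in\mathcal D^{1,2}(\mathbb R^d)$ is radially symmetric and $\int_{\mathbb R^d}\frac{|u|^2}{|x|^2}\,dx=1$, then \[ \int_{\mathbb R^d}\frac{|u|^2}{|x|^2}\,\log\left(|x|^{d-2}|u|^2\right)dx\;\le\;\frac d2\,\log\left[\mathsf C^*_{\rm LH}\int_{\mathbb R^d}|\nabla u|^2\,dx\right], \] where the positive part of the integrand on the left is integrable, so that the integral is well defined in $[-\infty,\infty)$. Equality is achieved, with all integrals finite, by the radial function \[ u=\tilde u\left(\int_{\mathbb R^d}\frac{|\tilde u|^2}{|x|^2}\,dx\right)^{-1/2},\qquad \tilde u(x)=|x|^{-\frac{d-2}2}\exp\left(-\frac{(d-2)^2}{4(d-1)}\,(\log|x|)^2\right),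 \] which belongs to $\mathcal D^{1,2}(\mathbb R^d)$ and satisfies $\int_{\mathbb R^d}|u|^2/|x|^2\,dx=1$. -/

import Mathlib

open MeasureTheory Filter Topology
open scoped ENNReal ContDiff

/-- `u` belongs to `𝒟^{1,2}(ℝᵈ)`, the completion of the smooth compactly supported functions for
the norm `‖∇φ‖_{L²}`, and `G` is its (weak) gradient. For `d ≥ 3` the completion is realized, as
usual, as a space of functions in `L^{2d/(d-2)}` (Sobolev embedding): `u` is the limit in that space
of test functions whose gradients converge to `G` in `L²`. In particular `G` is determined
by `u` almost everywhere, and the norm of `u` is `‖G‖_{L²}`. -/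
def HasGradD12 {d : ℕ} (u : EuclideanSpace ℝ (Fin d) → ℝ)
    (G : EuclideanSpace ℝ (Fin d) → EuclideanSpace ℝ (Fin d)) : Prop :=
  MemLp u (ENNReal.ofReal (2 * d / (d - 2))) volume ∧ MemLp G 2 volume ∧
  ∃ φ : ℕ → EuclideanSpace ℝ (Fin d) → ℝ,
    (∀ n, ContDiff ℝ ∞ (φ n) ∧ HasCompactSupport (φ n)) ∧
    Tendsto (fun n => eLpNorm (fun x => φ n x - u x)
      (ENNReal.ofReal (2 * d / (d - 2))) volume) atTop (𝓝 0) ∧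
    Tendsto (fun n => eLpNorm (fun x => gradient (φ n) x - G x) 2 volume) atTop (𝓝 0)

/-- `u` is (almost everywhere) a function of `‖x‖`. -/
def IsRadialAE {d : ℕ} (u : EuclideanSpace ℝ (Fin d) → ℝ) : Prop :=
  ∃ f : ℝ → ℝ, Measurable f ∧ ∀ᵐ x : EuclideanSpace ℝ (Fin d), u x = f ‖x‖

/-- The integrand `(|u|² / |x|²) log (|x|^{d-2} |u|²)`, with the usual convention `0 log 0 = 0`. -/
noncomputable def logHardyIntegrand {d : ℕ} (u : EuclideanSpace ℝ (Fin d) → ℝ)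
    (x : EuclideanSpace ℝ (Fin d)) : ℝ :=
  |u x| ^ 2 / ‖x‖ ^ 2 * Real.log (‖x‖ ^ ((d : ℝ) - 2) * |u x| ^ 2)

/-- The extended-real integral `∫ F⁺ - ∫ F⁻`; it is meaningful as soon as one of the two terms
is finite. -/
noncomputable def extIntegral {d : ℕ} (F : EuclideanSpace ℝ (Fin d) → ℝ) : EReal :=
  ((∫⁻ x, ENNReal.ofReal (F x) : ℝ≥0∞) : EReal) - ((∫⁻ x, ENNReal.ofReal (-F x) : ℝ≥0∞) : EReal)

/-- The constant `C*_LH` for radial functions in dimension `d`. -/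
noncomputable def radialLogHardyConst (d : ℕ) : ℝ :=
  4 / d * (Real.Gamma (d / 2) ^ ((2 : ℝ) / d) /
      (Real.pi * (8 * Real.pi * Real.exp 1) ^ ((1 : ℝ) / d))) *
    (((d : ℝ) - 1) / ((d : ℝ) - 2) ^ 2) ^ (1 - (1 : ℝ) / d)

/-- The profile `|x|^{-(d-2)/2} exp (-(d-2)² / (4 (d-1)) (log |x|)²)`. -/
noncomputable def radialLogHardyProfile (d : ℕ) (x : EuclideanSpace ℝ (Fin d)) : ℝ :=
  ‖x‖ ^ (-(((d : ℝ) - 2) / 2)) *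
    Real.exp (-(((d : ℝ) - 2) ^ 2 / (4 * ((d : ℝ) - 1)) * (Real.log ‖x‖) ^ 2))

/-- The profile divided by the square root of `∫ |ũ|² / |x|²`. -/
noncomputable def radialLogHardyExtremal (d : ℕ) (x : EuclideanSpace ℝ (Fin d)) : ℝ :=
  radialLogHardyProfile d x /
    √(∫ y : EuclideanSpace ℝ (Fin d), |radialLogHardyProfile d y| ^ 2 / ‖y‖ ^ 2)

/-! In the variable $s=\log|x|$ with $w(s)=e^{ks}u(e^s)$ and $k=(d-2)/2$, a radial function
satisfies $\int|u|^2/|x|^2=\omega\int w^2$, the logarithmic integral is $\omega\int w^2\log w^2$,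
and $\int|\nabla u|^2=\omega(\int w'^2+k^2\int w^2)$, where $\omega$ is the area of the sphere. The
claim thus becomes the sharp logarithmic Sobolev inequality on the line, followed by a scalar
optimization (`log_hardy_bound_le`) using only $\log y\le y-1$.

The one-dimensional inequality is proved by mass transport in `integral_sq_mul_log_le`: a monotone
map $T$ carries a density $\rho$ to the standard Gaussian, and $\log T'$ is bounded by a tangent
line, integrated by parts and absorbed in a square. The density $\rho$ is kept independent of the
test function $v$. The inequality is then quadratic in $v$ and passes to limits; only afterwards is
$\rho$ taken close to $w^2/N$.

The test functions approximating $u$ need not be radial. `exists_ray_approximation` selects a ray on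
which they and their gradients converge and whose energy does not exceed the spherical average. The
radial derivative is $e^{-(k+1)s}(W'-kW)$ in terms of $W=e^{ks}\varphi(e^s\theta)$, so what
converges in $L^2$ is the twisted derivative $W'-kW$. It controls the sup norm, so $w$ is bounded
and the positive part of the integrand is integrable; `entropy_le_of_tendsto_L2` carries the
inequality to the limit.

Equality holds for the Gaussian $w=c\,e^{-bs^2}$ with $b=(d-2)^2/(4(d-1))$, by explicit Gaussian
integrals. -/

/-! ### Logarithmic Sobolev inequality on the line by monotone transport -/

/-- A positive continuous probability density has a `C¹` cumulative distribution function which is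
an increasing bijection onto `(0, 1)`. -/
theorem exists_cdf_of_density {g : ℝ → ℝ} (hg : Continuous g) (hpos : ∀ x, 0 < g x)
    (hint : Integrable g) (h1 : ∫ x, g x = 1) :
    ∃ F : ℝ → ℝ, (∀ x, HasDerivAt F (g x) x) ∧ StrictMono F ∧ Set.range F = Set.Ioo 0 1 := by
  set c := ∫ x in Set.Iic (0 : ℝ), g x with hc
  set F : ℝ → ℝ := fun x => c + ∫ t in (0 : ℝ)..x, g t with hF
  have hderiv : ∀ x, HasDerivAt F (g x) x := fun x =>
    (intervalIntegral.integral_hasDerivAt_right (hg.intervalIntegrable _ _)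
      (hg.stronglyMeasurableAtFilter _ _) hg.continuousAt).const_add c
  have hmono : StrictMono F := strictMono_of_deriv_pos fun x => by
    rw [(hderiv x).deriv]; exact hpos x
  have hbot : Tendsto F atBot (𝓝 0) := by
    have := (intervalIntegral_tendsto_integral_Iic (0 : ℝ) hint.integrableOn tendsto_id).const_sub c
    simp only [id, ← hc, sub_self] at this
    refine this.congr fun x => ?_
    simp only [hF]
    rw [intervalIntegral.integral_symm 0 x]; ring
  have htop : Tendsto F atTop (𝓝 1) := by
    have := (intervalIntegral_tendsto_integral_Ioi (0 : ℝ) hint.integrableOn tendsto_id).const_add c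
    have h2 : c + ∫ x in Set.Ioi (0 : ℝ), g x = 1 := by
      rw [hc, ← h1]
      exact intervalIntegral.integral_Iic_add_Ioi hint.integrableOn hint.integrableOn
    rw [h2] at this
    exact this
  have hcont : Continuous F := continuous_iff_continuousAt.2 fun x => (hderiv x).continuousAt
  refine ⟨F, hderiv, hmono, Set.Subset.antisymm ?_ ?_⟩
  · rintro _ ⟨x, rfl⟩
    constructor
    · have h := hmono.monotone.le_of_tendsto hbot (x - 1)
      exact h.trans_lt (hmono (by linarith))
    · have h := hmono.monotone.ge_of_tendsto htop (x + 1)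
      exact (hmono (by linarith)).trans_le h
  · rintro y ⟨h0, h1⟩
    exact mem_range_of_exists_le_of_exists_ge hcont
      ((hbot.eventually (eventually_le_nhds h0)).exists)
      ((htop.eventually (eventually_ge_nhds h1)).exists)

/-- Monotone transport between two positive continuous probability densities on the line. -/
theorem exists_monotone_transport {g h : ℝ → ℝ} (hg : Continuous g) (gpos : ∀ x, 0 < g x)
    (gint : Integrable g) (g1 : ∫ x, g x = 1) (hh : Continuous h) (hpos : ∀ x, 0 < h x)
    (hint : Integrable h) (h1 : ∫ x, h x = 1) :
    ∃ T : ℝ → ℝ, ∀ x, HasDerivAt T (g x / h (T x)) x := by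
  obtain ⟨F, Fd, Fm, Fr⟩ := exists_cdf_of_density hg gpos gint g1
  obtain ⟨H, Hd, Hm, Hr⟩ := exists_cdf_of_density hh hpos hint h1
  -- `invFun` is the true inverse only on the range $(0,1)$ of `H`; its values elsewhere play no
  -- role, since `F` also takes values in $(0,1)$.
  set J := Function.invFun H
  have hJ : ∀ y ∈ Set.Ioo (0 : ℝ) 1, H (J y) = y := fun y hy =>
    Function.invFun_eq (by rw [← Hr] at hy; exact hy)
  have hJ' : ∀ x, J (H x) = x := Function.leftInverse_invFun Hm.injective
  have Jm : StrictMonoOn J (Set.Ioo 0 1) := fun a ha b hb hab => by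
    rw [← Hm.lt_iff_lt, hJ a ha, hJ b hb]; exact hab
  -- A monotone function whose image is a neighbourhood of its value cannot jump; here the image of
  -- $(0,1)$ is the whole line.
  have Jc : ∀ y ∈ Set.Ioo (0 : ℝ) 1, ContinuousAt J y := fun y hy =>
    Jm.continuousAt_of_image_mem_nhds (isOpen_Ioo.mem_nhds hy) (by
      convert univ_mem
      exact Set.eq_univ_of_forall fun x => ⟨H x, by rw [← Hr]; exact ⟨x, rfl⟩, hJ' x⟩)
  refine ⟨fun x => J (F x), fun x => ?_⟩
  have hx : F x ∈ Set.Ioo (0 : ℝ) 1 := by rw [← Fr]; exact ⟨x, rfl⟩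
  have key : HasDerivAt J (h (J (F x)))⁻¹ (F x) :=
    HasDerivAt.of_local_left_inverse (Jc _ hx) (Hd _) (hpos _).ne'
      (by filter_upwards [isOpen_Ioo.mem_nhds hx] with y hy using hJ y hy)
  have := key.comp x (Fd x)
  rwa [inv_mul_eq_div] at this

/-- Dual form of the logarithmic Sobolev inequality on the line, with respect to a reference
probability density `ρ`. -/
theorem integral_sq_mul_log_le {ρ : ℝ → ℝ} (hρ : Continuous ρ) (ρpos : ∀ x, 0 < ρ x)
    (ρint : Integrable ρ) (ρ1 : ∫ x, ρ x = 1) {v v' : ℝ → ℝ} (hv : ∀ x, HasDerivAt v (v' x) x)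
    (hv' : Continuous v') (hsupp : HasCompactSupport v) {κ : ℝ} (hκ : 0 < κ) :
    ∫ x, v x ^ 2 * Real.log (ρ x) ≤ 1 / (2 * κ ^ 2) * (∫ x, v' x ^ 2) -
      (Real.log (2 * Real.pi) / 2 + 1 - Real.log (2 * κ)) * ∫ x, v x ^ 2 := by
  set γ : ℝ → ℝ := ProbabilityTheory.gaussianPDFReal 0 1 with hγ
  have γc : Continuous γ := by
    rw [hγ]; unfold ProbabilityTheory.gaussianPDFReal; fun_prop
  have γpos : ∀ x, 0 < γ x := fun x =>
    ProbabilityTheory.gaussianPDFReal_pos _ _ _ one_ne_zero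
  obtain ⟨T, hT⟩ := exists_monotone_transport hρ ρpos ρint ρ1 γc γpos
    (ProbabilityTheory.integrable_gaussianPDFReal 0 1)
    (ProbabilityTheory.integral_gaussianPDFReal_eq_one 0 one_ne_zero)
  set T' : ℝ → ℝ := fun x => ρ x / γ (T x) with hT'
  have Tc : Continuous T := continuous_iff_continuousAt.2 fun x => (hT x).continuousAt
  have T'c : Continuous T' := hρ.div (γc.comp Tc) fun x => (γpos _).ne'
  have T'pos : ∀ x, 0 < T' x := fun x => div_pos (ρpos _) (γpos _)
  have vc : Continuous v := continuous_iff_continuousAt.2 fun x => (hv x).continuousAt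
  have hsupp' : HasCompactSupport v' := by
    have : v' = deriv v := by ext x; exact (hv x).deriv.symm
    rw [this]; exact hsupp.deriv
  -- Logarithm of the Monge–Ampère equation $\rho=T'\,\gamma(T)$.
  have logρ : ∀ x, Real.log (ρ x) = Real.log (T' x) - T x ^ 2 / 2 - Real.log (2 * Real.pi) / 2 := by
    intro x
    have : ρ x = T' x * γ (T x) := by rw [hT']; field_simp [(γpos (T x)).ne']
    rw [this, Real.log_mul (T'pos x).ne' (γpos _).ne', hγ]
    unfold ProbabilityTheory.gaussianPDFReal
    rw [Real.log_mul (by positivity) (Real.exp_ne_zero _), Real.log_exp, Real.log_inv,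
      Real.log_sqrt (by positivity)]
    simp; ring
  have cs1 : HasCompactSupport fun x => v x ^ 2 := by
    rw [show (fun x => v x ^ 2) = v * v from funext fun x => pow_two _]
    exact hsupp.mul_left
  have cs2 : HasCompactSupport fun x => v' x ^ 2 := by
    rw [show (fun x => v' x ^ 2) = v' * v' from funext fun x => pow_two _]
    exact hsupp'.mul_left
  have i1 : Integrable fun x => v x ^ 2 := (vc.pow 2).integrable_of_hasCompactSupport cs1
  have i2 : Integrable fun x => v' x ^ 2 := (hv'.pow 2).integrable_of_hasCompactSupport cs2
  have i3 : Integrable fun x => v x ^ 2 * Real.log (ρ x) :=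
    ((vc.pow 2).mul (hρ.log fun x => (ρpos x).ne')).integrable_of_hasCompactSupport
      (cs1.mul_right (f' := fun x => Real.log (ρ x)))
  -- The exact derivative $(v^2T)'$ integrates to zero, which trades $v^2T'$ for $-2vv'T$.
  have hd : ∀ x, HasDerivAt (fun x => v x ^ 2 * T x) (v x ^ 2 * T' x + v x * (2 * v' x * T x)) x := by
    intro x
    refine (((hv x).pow 2).mul (hT x)).congr_deriv ?_
    simp only [Pi.pow_apply, hT']
    push_cast; ring
  have i4 : Integrable fun x => v x ^ 2 * T x :=
    ((vc.pow 2).mul Tc).integrable_of_hasCompactSupport (cs1.mul_right (f' := T))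
  have i5 : Integrable fun x => v x ^ 2 * T' x + v x * (2 * v' x * T x) :=
    (((vc.pow 2).mul T'c).integrable_of_hasCompactSupport (cs1.mul_right (f' := T'))).add
      ((vc.mul ((continuous_const.mul hv').mul Tc)).integrable_of_hasCompactSupport
        (hsupp.mul_right (f' := fun x => 2 * v' x * T x)))
  have h0 := integral_eq_zero_of_hasDerivAt_of_integrable hd i5 i4
  set C := Real.log (2 * Real.pi) / 2 + 1 - Real.log (2 * κ) with hC
  -- The tangent line of the logarithm at $2\kappa$ bounds $\log T'$, and the square $(v'+\kappa
  -- vT)^2\ge0$ absorbs the term $-v^2T^2/2$. Both are equalities for a Gaussian $v$ of the right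
  -- width, with $\rho$ proportional to $v^2$ and $T'=2\kappa$.
  have pw : ∀ x, v x ^ 2 * Real.log (ρ x) + C * v x ^ 2 ≤ 1 / (2 * κ ^ 2) * v' x ^ 2 +
      1 / (2 * κ) * (v x ^ 2 * T' x + v x * (2 * v' x * T x)) := by
    intro x
    have hl : Real.log (T' x) - Real.log (2 * κ) ≤ T' x / (2 * κ) - 1 := by
      rw [← Real.log_div (T'pos x).ne' (by positivity)]
      exact Real.log_le_sub_one_of_pos (div_pos (T'pos x) (by positivity))
    have hl2 := mul_le_mul_of_nonneg_left hl (sq_nonneg (v x))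
    have hs : 0 ≤ 1 / (2 * κ ^ 2) * (v' x + κ * v x * T x) ^ 2 := by positivity
    have he : 1 / (2 * κ ^ 2) * (v' x + κ * v x * T x) ^ 2 = 1 / (2 * κ ^ 2) * v' x ^ 2 +
      1 / (2 * κ) * (v x * (2 * v' x * T x)) + v x ^ 2 * T x ^ 2 / 2 := by
      field_simp; ring
    have he2 : v x ^ 2 * (T' x / (2 * κ) - 1) = 1 / (2 * κ) * (v x ^ 2 * T' x) - v x ^ 2 := by
      field_simp
    rw [logρ, hC]
    linarith
  have := integral_mono (i3.add (i1.const_mul C))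
    ((i2.const_mul (1 / (2 * κ ^ 2))).add (i5.const_mul (1 / (2 * κ)))) pw
  simp only [Pi.add_apply] at this
  rw [integral_add i3 (i1.const_mul C), integral_add (i2.const_mul _) (i5.const_mul _),
    integral_const_mul, integral_const_mul, integral_const_mul, h0] at this
  linarith

/-! ### Energy estimates for $W$ and its twisted derivative $W'-kW$ -/

/-- `W` is continuously differentiable with derivative `W'`, and both are square integrable. -/
structure IsH1Pair (W W' : ℝ → ℝ) : Prop where
  hasDerivAt : ∀ x, HasDerivAt W (W' x) x
  continuous' : Continuous W'
  sq : Integrable fun x => W x ^ 2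
  sq' : Integrable fun x => W' x ^ 2

namespace IsH1Pair

variable {W W' V V' : ℝ → ℝ}

theorem continuous (h : IsH1Pair W W') : Continuous W :=
  continuous_iff_continuousAt.2 fun x => (h.hasDerivAt x).continuousAt

theorem integrable_mul (h : IsH1Pair W W') : Integrable fun x => 2 * (W x * W' x) := by
  refine (h.sq.add h.sq').mono' ((continuous_const.mul
    (h.continuous.mul h.continuous')).aestronglyMeasurable) (Eventually.of_forall fun x => ?_)
  rw [Real.norm_eq_abs, abs_le]
  constructor <;> simp only [Pi.add_apply] <;>
    nlinarith [sq_nonneg (W x + W' x), sq_nonneg (W x - W' x)]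

theorem hasDerivAt_sq (h : IsH1Pair W W') (x : ℝ) :
    HasDerivAt (fun x => W x ^ 2) (2 * (W x * W' x)) x := by
  refine ((h.hasDerivAt x).pow 2).congr_deriv ?_
  push_cast; ring

theorem sub (h : IsH1Pair W W') (g : IsH1Pair V V') :
    IsH1Pair (fun x => W x - V x) (fun x => W' x - V' x) where
  hasDerivAt x := (h.hasDerivAt x).sub (g.hasDerivAt x)
  continuous' := h.continuous'.sub g.continuous'
  sq := by
    refine ((h.sq.add g.sq).const_mul 2).mono'
      ((h.continuous.sub g.continuous).pow 2).aestronglyMeasurable (Eventually.of_forall fun x => ?_)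
    rw [Real.norm_of_nonneg (sq_nonneg _)]
    simp only [Pi.add_apply]
    nlinarith [sq_nonneg (W x + V x)]
  sq' := by
    refine ((h.sq'.add g.sq').const_mul 2).mono'
      ((h.continuous'.sub g.continuous').pow 2).aestronglyMeasurable
      (Eventually.of_forall fun x => ?_)
    rw [Real.norm_of_nonneg (sq_nonneg _)]
    simp only [Pi.add_apply]
    nlinarith [sq_nonneg (W' x + V' x)]

theorem integrable_sub_sq (h : IsH1Pair W W') (k : ℝ) :
    Integrable fun x => (W' x - k * W x) ^ 2 := by
  have := (h.sq'.sub (h.integrable_mul.const_mul k)).add (h.sq.const_mul (k ^ 2))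
  refine this.congr (Eventually.of_forall fun x => ?_)
  simp only [Pi.add_apply, Pi.sub_apply]; ring

/-- The cross term $2WW'$ is the derivative of the integrable function $W^2$, so its integral
vanishes. -/
theorem integral_sub_sq (h : IsH1Pair W W') (k : ℝ) :
    ∫ x, (W' x - k * W x) ^ 2 = (∫ x, W' x ^ 2) + k ^ 2 * ∫ x, W x ^ 2 := by
  have h0 := integral_eq_zero_of_hasDerivAt_of_integrable h.hasDerivAt_sq h.integrable_mul h.sq
  have e : ∀ x, (W' x - k * W x) ^ 2 = W' x ^ 2 - k * (2 * (W x * W' x)) + k ^ 2 * W x ^ 2 :=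
    fun x => by ring
  simp_rw [e]
  have hi : Integrable fun x => W' x ^ 2 - k * (2 * (W x * W' x)) :=
    h.sq'.sub (h.integrable_mul.const_mul k)
  rw [integral_add hi (h.sq.const_mul _), integral_sub h.sq' (h.integrable_mul.const_mul k), integral_const_mul k, h0, integral_const_mul]
  ring

/-- One-dimensional Sobolev embedding: $W(x)^2=\int_{-\infty}^x2WW'$ and $2WW'\le W^2+W'^2$. -/
theorem sq_le (h : IsH1Pair W W') (x : ℝ) :
    W x ^ 2 ≤ (∫ x, W x ^ 2) + ∫ x, W' x ^ 2 := by
  have t := tendsto_zero_of_hasDerivAt_of_integrableOn_Iic (a := x)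
    (fun y _ => h.hasDerivAt_sq y) h.integrable_mul.integrableOn h.sq.integrableOn
  have e := integral_Iic_of_hasDerivAt_of_tendsto' (a := x) (fun y _ => h.hasDerivAt_sq y)
    h.integrable_mul.integrableOn t
  rw [sub_zero] at e
  have hi : Integrable fun x => W x ^ 2 + W' x ^ 2 := h.sq.add h.sq'
  rw [← e, ← integral_add h.sq h.sq']
  calc ∫ y in Set.Iic x, 2 * (W y * W' y) ≤ ∫ y in Set.Iic x, (W y ^ 2 + W' y ^ 2) :=
        integral_mono h.integrable_mul.integrableOn hi.integrableOn fun y => by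
          nlinarith [sq_nonneg (W y - W' y)]
    _ ≤ ∫ y, (W y ^ 2 + W' y ^ 2) := setIntegral_le_integral hi
        (Eventually.of_forall fun y => add_nonneg (sq_nonneg _) (sq_nonneg _))

/-- Turns $L^2$ control of the twisted derivative, the only quantity known to converge, into sup
norm control. -/
theorem mul_sq_le (h : IsH1Pair W W') {k : ℝ} (hk : 0 < k) (x : ℝ) :
    W x ^ 2 ≤ (1 + 1 / k ^ 2) * ∫ x, (W' x - k * W x) ^ 2 := by
  have h1 := h.sq_le x
  rw [h.integral_sub_sq k]
  have a0 : 0 ≤ ∫ x, W x ^ 2 := integral_nonneg fun x => sq_nonneg _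
  have b0 : 0 ≤ ∫ x, W' x ^ 2 := integral_nonneg fun x => sq_nonneg _
  have : (1 + 1 / k ^ 2) * ((∫ x, W' x ^ 2) + k ^ 2 * ∫ x, W x ^ 2) =
    (∫ x, W' x ^ 2) + (1 / k ^ 2) * (∫ x, W' x ^ 2) + k ^ 2 * (∫ x, W x ^ 2) + ∫ x, W x ^ 2 := by
    field_simp; ring
  rw [this]
  have : 0 ≤ (1 / k ^ 2) * (∫ x, W' x ^ 2) + k ^ 2 * (∫ x, W x ^ 2) := by positivity
  linarith

/-- The dual logarithmic Sobolev inequality for the truncation `χ W`. -/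
theorem integral_cutoff_le (h : IsH1Pair W W') {k : ℝ} (hk : 0 < k) {ρ : ℝ → ℝ}
    (hρ : Continuous ρ) (ρpos : ∀ x, 0 < ρ x) (ρint : Integrable ρ) (ρ1 : ∫ x, ρ x = 1)
    {χ χ' : ℝ → ℝ} (hχ : ∀ x, HasDerivAt χ (χ' x) x) (hχ' : Continuous χ')
    (hsupp : HasCompactSupport χ) (χ1 : ∀ x, χ x ^ 2 ≤ 1) {L : ℝ} (hL : ∀ x, χ' x ^ 2 ≤ L)
    {κ δ : ℝ} (hκ : 0 < κ) (hδ : 0 < δ) :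
    ∫ x, χ x ^ 2 * Real.log (ρ x) * W x ^ 2 ≤ 1 / (2 * κ ^ 2) *
      ((1 + δ) * ((∫ x, (W' x - k * W x) ^ 2) - k ^ 2 * ∫ x, χ x ^ 2 * W x ^ 2) +
        (1 + 1 / δ) * L * ((∫ x, (W' x - k * W x) ^ 2) / k ^ 2)) -
      (Real.log (2 * Real.pi) / 2 + 1 - Real.log (2 * κ)) * ∫ x, χ x ^ 2 * W x ^ 2 := by
  have χc : Continuous χ := continuous_iff_continuousAt.2 fun x => (hχ x).continuousAt
  have L0 : 0 ≤ L := (sq_nonneg _).trans (hL 0)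
  have hv : ∀ x, HasDerivAt (fun x => χ x * W x) (χ' x * W x + χ x * W' x) x := fun x =>
    (hχ x).mul (h.hasDerivAt x)
  have hv' : Continuous fun x => χ' x * W x + χ x * W' x :=
    (hχ'.mul h.continuous).add (χc.mul h.continuous')
  have hs : HasCompactSupport fun x => χ x * W x := hsupp.mul_right (f' := W)
  have main := integral_sq_mul_log_le hρ ρpos ρint ρ1 hv hv' hs hκ
  have e1 : ∀ x, (χ x * W x) ^ 2 * Real.log (ρ x) = χ x ^ 2 * Real.log (ρ x) * W x ^ 2 :=
    fun x => by ring
  have e2 : ∀ x, (χ x * W x) ^ 2 = χ x ^ 2 * W x ^ 2 := fun x => by ring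
  simp_rw [e1, e2] at main
  have hbi : Integrable fun x => (1 + δ) * W' x ^ 2 + (1 + 1 / δ) * L * W x ^ 2 :=
    (h.sq'.const_mul _).add (h.sq.const_mul _)
  have hpw : ∀ x, (χ' x * W x + χ x * W' x) ^ 2 ≤
      (1 + δ) * W' x ^ 2 + (1 + 1 / δ) * L * W x ^ 2 := by
    intro x
    -- Young's inequality with parameter `δ`: the main energy term keeps a constant tending to 1, so
    -- the sharp constant survives when the cutoff is removed.
    have h1 : (χ' x * W x + χ x * W' x) ^ 2 ≤
        (1 + δ) * (χ x * W' x) ^ 2 + (1 + 1 / δ) * (χ' x * W x) ^ 2 := by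
      have : (1 + δ) * (χ x * W' x) ^ 2 + (1 + 1 / δ) * (χ' x * W x) ^ 2 -
        (χ' x * W x + χ x * W' x) ^ 2 = 1 / δ * (δ * (χ x * W' x) - χ' x * W x) ^ 2 := by
        field_simp; ring
      have h2 : 0 ≤ 1 / δ * (δ * (χ x * W' x) - χ' x * W x) ^ 2 := by positivity
      linarith
    refine h1.trans ?_
    rw [mul_pow, mul_pow, mul_assoc (1 + 1 / δ)]
    gcongr
    · exact mul_le_of_le_one_left (sq_nonneg _) (χ1 x)
    · exact hL x
  have hb := integral_mono_of_nonneg (Eventually.of_forall fun x => sq_nonneg _) hbi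
    (Eventually.of_forall hpw)
  rw [integral_add (h.sq'.const_mul _) (h.sq.const_mul _), integral_const_mul,
    integral_const_mul] at hb
  have hq := h.integral_sub_sq k
  have a0 : 0 ≤ ∫ x, W' x ^ 2 := integral_nonneg fun x => sq_nonneg _
  have hχW : ∫ x, χ x ^ 2 * W x ^ 2 ≤ ∫ x, W x ^ 2 :=
    integral_mono_of_nonneg (Eventually.of_forall fun x => by positivity) h.sq
      (Eventually.of_forall fun x => mul_le_of_le_one_left (sq_nonneg _) (χ1 x))
  refine main.trans (sub_le_sub_right (mul_le_mul_of_nonneg_left (hb.trans ?_) (by positivity)) _)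
  -- Only the truncated mass is subtracted: it passes to the limit under uniform convergence,
  -- whereas the full mass $\int W^2$ need not under that convergence alone.
  have f1 : ∫ x, W' x ^ 2 ≤ (∫ x, (W' x - k * W x) ^ 2) - k ^ 2 * ∫ x, χ x ^ 2 * W x ^ 2 := by
    rw [hq]; nlinarith [mul_le_mul_of_nonneg_left hχW (sq_nonneg k)]
  have f2 : ∫ x, W x ^ 2 ≤ (∫ x, (W' x - k * W x) ^ 2) / k ^ 2 := by
    rw [hq, le_div_iff₀ (by positivity)]; linarith
  gcongr

end IsH1Pair

/-! ### Passage to the limit and removal of the cutoff -/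

/-- A sequence of `C¹` functions for which `W' - k W` converges in `L²` converges uniformly to a
bounded continuous function. -/
theorem exists_tendstoUniformly_of_tendsto_L2 {k : ℝ} (hk : 0 < k) {W W' : ℕ → ℝ → ℝ}
    (hW : ∀ n, IsH1Pair (W n) (W' n)) {P : ℝ → ℝ} (hP : MemLp P 2)
    (hconv : Tendsto (fun n => ∫ x, (W' n x - k * W n x - P x) ^ 2) atTop (𝓝 0)) :
    ∃ w : ℝ → ℝ, Continuous w ∧ (∃ M, ∀ x, |w x| ≤ M) ∧ TendstoUniformly W w atTop := by
  set η : ℕ → ℝ := fun n => ∫ x, (W' n x - k * W n x - P x) ^ 2 with hη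
  have hQ : ∀ n, MemLp (fun x => W' n x - k * W n x) 2 := fun n =>
    (memLp_two_iff_integrable_sq ((hW n).continuous'.sub
      (continuous_const.mul (hW n).continuous)).aestronglyMeasurable).2 ((hW n).integrable_sub_sq k)
  have hQP : ∀ n, Integrable fun x => (W' n x - k * W n x - P x) ^ 2 := fun n =>
    ((hQ n).sub hP).integrable_sq
  set B := 2 * (1 + 1 / k ^ 2) with hB
  have B0 : 0 < B := by positivity
  -- `mul_sq_le` is applied to $W_n-W_m$, whose twisted derivative is at $L^2$ distance at most
  -- $\sqrt{\eta_n}+\sqrt{\eta_m}$ from zero through `P`.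
  have hcau : ∀ n m x, (W n x - W m x) ^ 2 ≤ B * (η n + η m) := by
    intro n m x
    refine (((hW n).sub (hW m)).mul_sq_le hk x).trans ?_
    rw [hB, mul_comm 2, mul_assoc]
    refine mul_le_mul_of_nonneg_left ?_ (by positivity)
    rw [hη, ← integral_add (hQP n) (hQP m), ← integral_const_mul]
    refine integral_mono (((hW n).sub (hW m)).integrable_sub_sq k)
      (((hQP n).add (hQP m)).const_mul 2) fun x => ?_
    simp only
    nlinarith [sq_nonneg ((W' n x - k * W n x - P x) + (W' m x - k * W m x - P x))]
  have hlim : ∀ x, ∃ l, Tendsto (fun n => W n x) atTop (𝓝 l) := by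
    intro x
    refine cauchySeq_tendsto_of_complete (Metric.cauchySeq_iff.2 fun ε hε => ?_)
    have := (hconv.eventually (gt_mem_nhds (show 0 < ε ^ 2 / (2 * B) by positivity)))
    obtain ⟨N, hN⟩ := eventually_atTop.1 this
    refine ⟨N, fun m hm n hn => ?_⟩
    rw [Real.dist_eq]
    refine abs_lt_of_sq_lt_sq ((hcau m n x).trans_lt ?_) hε.le
    have h1 := hN m hm
    have h2 := hN n hn
    calc B * (η m + η n) < B * (ε ^ 2 / (2 * B) + ε ^ 2 / (2 * B)) := by gcongr
      _ = ε ^ 2 := by field_simp; ring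
  choose w hw using hlim
  have hbound : ∀ n x, (W n x - w x) ^ 2 ≤ B * η n := by
    intro n x
    have t1 : Tendsto (fun m => (W n x - W m x) ^ 2) atTop (𝓝 ((W n x - w x) ^ 2)) :=
      ((hw x).const_sub _).pow 2
    have t2 : Tendsto (fun m => B * (η n + η m)) atTop (𝓝 (B * (η n + 0))) :=
      (hconv.const_add _).const_mul _
    rw [add_zero] at t2
    exact le_of_tendsto_of_tendsto' t1 t2 fun m => hcau n m x
  have hunif : TendstoUniformly W w atTop := by
    rw [Metric.tendstoUniformly_iff]
    intro ε hε
    have := (hconv.eventually (gt_mem_nhds (show 0 < ε ^ 2 / B by positivity)))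
    filter_upwards [this] with n hn x
    rw [dist_comm, Real.dist_eq]
    refine abs_lt_of_sq_lt_sq ((hbound n x).trans_lt ?_) hε.le
    calc B * η n < B * (ε ^ 2 / B) := by gcongr
      _ = ε ^ 2 := by field_simp
  refine ⟨w, hunif.continuous (Frequently.of_forall fun n => (hW n).continuous), ?_, hunif⟩
  refine ⟨√(B * η 0) + √((1 + 1 / k ^ 2) * ∫ x, (W' 0 x - k * W 0 x) ^ 2), fun x => ?_⟩
  have h1 := Real.abs_le_sqrt (hbound 0 x)
  have h2 := Real.abs_le_sqrt ((hW 0).mul_sq_le hk x)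
  have h3 := abs_sub_abs_le_abs_sub (w x) (W 0 x)
  rw [abs_sub_comm] at h3
  linarith

/-- Used with the compactly supported weights $\chi^2$ and $\chi^2\log\rho$, which are integrable
although $\log\rho$ need not be. -/
theorem tendsto_integral_mul_sq_of_tendstoUniformly {W : ℕ → ℝ → ℝ} {w h : ℝ → ℝ}
    (hW : ∀ n, Continuous (W n)) (hunif : TendstoUniformly W w atTop) {M : ℝ}
    (hM : ∀ x, |w x| ≤ M) (hh : Integrable h) :
    Tendsto (fun n => ∫ x, h x * W n x ^ 2) atTop (𝓝 (∫ x, h x * w x ^ 2)) := by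
  refine tendsto_integral_filter_of_dominated_convergence (fun x => |h x| * (M + 1) ^ 2)
    (Eventually.of_forall fun n => hh.aestronglyMeasurable.mul ((hW n).pow 2).aestronglyMeasurable)
    ?_ (hh.abs.mul_const _) (Eventually.of_forall fun x => ?_)
  · filter_upwards [Metric.tendstoUniformly_iff.1 hunif 1 one_pos] with n hn
    refine Eventually.of_forall fun x => ?_
    rw [norm_mul, Real.norm_eq_abs, norm_pow, Real.norm_eq_abs]
    have h1 := hn x
    rw [dist_comm, Real.dist_eq] at h1
    have h2 := abs_sub_abs_le_abs_sub (W n x) (w x)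
    have h3 := hM x
    gcongr
    linarith
  · exact ((hunif.tendsto_at x).pow 2).const_mul _

theorem exists_smooth_cutoff : ∃ χ : ℝ → ℝ, ContDiff ℝ ∞ χ ∧ HasCompactSupport χ ∧
    (∀ x, 0 ≤ χ x) ∧ (∀ x, χ x ≤ 1) ∧ (∀ x, |x| ≤ 1 → χ x = 1) ∧ ∃ C, ∀ x, |deriv χ x| ≤ C := by
  let f : ContDiffBump (0 : ℝ) := ⟨1, 2, one_pos, one_lt_two⟩
  have hf : ContDiff ℝ ∞ (f : ℝ → ℝ) := f.contDiff
  refine ⟨f, hf, f.hasCompactSupport, fun x => f.nonneg, fun x => f.le_one,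
    fun x hx => f.one_of_mem_closedBall ?_, ?_⟩
  · simpa [f] using hx
  · obtain ⟨C, hC⟩ := f.hasCompactSupport.deriv.exists_bound_of_continuous
      (hf.continuous_deriv (by simp))
    exact ⟨C, fun x => by simpa using hC x⟩

theorem integrable_sq_cutoff_mul {χ h : ℝ → ℝ} (hχ : Continuous χ) (hsupp : HasCompactSupport χ)
    (hh : Continuous h) : Integrable fun x => χ x ^ 2 * h x := by
  refine Continuous.integrable_of_hasCompactSupport ((hχ.pow 2).mul hh) ?_
  have : (fun x => χ x ^ 2 * h x) = χ * (fun x => χ x * h x) := by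
    ext x; simp only [Pi.mul_apply]; ring
  rw [this]
  exact hsupp.mul_right

/-- The dual logarithmic Sobolev inequality for a truncation of the limit of a sequence whose
twisted derivatives `W' - k W` converge in `L²`. -/
theorem integral_cutoff_limit_le {k : ℝ} (hk : 0 < k) {W W' : ℕ → ℝ → ℝ}
    (hW : ∀ n, IsH1Pair (W n) (W' n)) {P : ℝ → ℝ} (hP : MemLp P 2)
    (hconv : Tendsto (fun n => ∫ x, (W' n x - k * W n x - P x) ^ 2) atTop (𝓝 0))
    {w : ℝ → ℝ} {M : ℝ} (hM : ∀ x, |w x| ≤ M) (hunif : TendstoUniformly W w atTop)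
    {ρ : ℝ → ℝ} (hρ : Continuous ρ) (ρpos : ∀ x, 0 < ρ x) (ρint : Integrable ρ)
    (ρ1 : ∫ x, ρ x = 1) {χ χ' : ℝ → ℝ} (hχ : ∀ x, HasDerivAt χ (χ' x) x) (hχ' : Continuous χ')
    (hsupp : HasCompactSupport χ) (χ1 : ∀ x, χ x ^ 2 ≤ 1) {L : ℝ} (hL : ∀ x, χ' x ^ 2 ≤ L)
    {κ δ : ℝ} (hκ : 0 < κ) (hδ : 0 < δ) :
    (k ^ 2 * ∫ x, χ x ^ 2 * w x ^ 2) ≤ (1 + δ) * ∫ x, P x ^ 2 ∧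
    ∫ x, χ x ^ 2 * Real.log (ρ x) * w x ^ 2 ≤ 1 / (2 * κ ^ 2) *
      ((1 + δ) * ((1 + δ) * (∫ x, P x ^ 2) - k ^ 2 * ∫ x, χ x ^ 2 * w x ^ 2) +
        (1 + 1 / δ) * L * ((1 + δ) * (∫ x, P x ^ 2) / k ^ 2)) -
      (Real.log (2 * Real.pi) / 2 + 1 - Real.log (2 * κ)) * ∫ x, χ x ^ 2 * w x ^ 2 := by
  have χc : Continuous χ := continuous_iff_continuousAt.2 fun x => (hχ x).continuousAt
  have L0 : 0 ≤ L := (sq_nonneg _).trans (hL 0)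
  have csχ : HasCompactSupport fun x => χ x ^ 2 := by
    rw [show (fun x => χ x ^ 2) = χ * χ from funext fun x => pow_two _]
    exact hsupp.mul_left
  have iχ : Integrable fun x => χ x ^ 2 := (χc.pow 2).integrable_of_hasCompactSupport csχ
  have iχρ : Integrable fun x => χ x ^ 2 * Real.log (ρ x) :=
    integrable_sq_cutoff_mul χc hsupp (hρ.log fun x => (ρpos x).ne')
  have tX := tendsto_integral_mul_sq_of_tendstoUniformly (fun n => (hW n).continuous) hunif hM iχρ
  have tY := tendsto_integral_mul_sq_of_tendstoUniformly (fun n => (hW n).continuous) hunif hM iχ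
  have hQ : ∀ n, MemLp (fun x => W' n x - k * W n x) 2 := fun n =>
    (memLp_two_iff_integrable_sq ((hW n).continuous'.sub
      (continuous_const.mul (hW n).continuous)).aestronglyMeasurable).2 ((hW n).integrable_sub_sq k)
  have hQP : ∀ n, Integrable fun x => (W' n x - k * W n x - P x) ^ 2 := fun n =>
    ((hQ n).sub hP).integrable_sq
  -- Young's inequality again: `Z n` dominates the twisted energy of `W n` and tends to
  -- $(1+\delta)\int P^2$; the extra factor disappears with `δ`.
  set Z : ℕ → ℝ := fun n => (1 + δ) * (∫ x, P x ^ 2) +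
    (1 + 1 / δ) * ∫ x, (W' n x - k * W n x - P x) ^ 2 with hZ
  have tZ : Tendsto Z atTop (𝓝 ((1 + δ) * ∫ x, P x ^ 2)) := by
    have := (hconv.const_mul (1 + 1 / δ)).const_add ((1 + δ) * ∫ x, P x ^ 2)
    rwa [mul_zero, add_zero] at this
  have hQZ : ∀ n, ∫ x, (W' n x - k * W n x) ^ 2 ≤ Z n := by
    intro n
    rw [hZ]
    simp only
    rw [← integral_const_mul, ← integral_const_mul,
      ← integral_add (hP.integrable_sq.const_mul _) ((hQP n).const_mul _)]
    refine integral_mono ((hW n).integrable_sub_sq k)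
      ((hP.integrable_sq.const_mul _).add ((hQP n).const_mul _)) fun x => ?_
    simp only
    generalize W' n x - k * W n x = a
    have e : (1 + δ) * P x ^ 2 + (1 + 1 / δ) * (a - P x) ^ 2 - a ^ 2 =
        1 / δ * (δ * P x - (a - P x)) ^ 2 := by field_simp; ring
    have : 0 ≤ 1 / δ * (δ * P x - (a - P x)) ^ 2 := by positivity
    linarith
  constructor
  · refine le_of_tendsto_of_tendsto' (tY.const_mul (k ^ 2)) tZ fun n => (le_trans ?_ (hQZ n))
    rw [(hW n).integral_sub_sq k]
    have hχW : ∫ x, χ x ^ 2 * W n x ^ 2 ≤ ∫ x, W n x ^ 2 :=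
      integral_mono_of_nonneg (Eventually.of_forall fun x => by positivity) (hW n).sq
        (Eventually.of_forall fun x => mul_le_of_le_one_left (sq_nonneg _) (χ1 x))
    have a0 : 0 ≤ ∫ x, W' n x ^ 2 := integral_nonneg fun x => sq_nonneg _
    nlinarith [mul_le_mul_of_nonneg_left hχW (sq_nonneg k)]
  · refine le_of_tendsto_of_tendsto' tX ((((((tZ.sub (tY.const_mul (k ^ 2))).const_mul (1 + δ)).add
      ((tZ.div_const (k ^ 2)).const_mul ((1 + 1 / δ) * L))).const_mul (1 / (2 * κ ^ 2))).sub
      (tY.const_mul (Real.log (2 * Real.pi) / 2 + 1 - Real.log (2 * κ))))) fun n => ?_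
    refine ((hW n).integral_cutoff_le hk hρ ρpos ρint ρ1 hχ hχ' hsupp χ1 hL hκ hδ).trans ?_
    have := hQZ n
    gcongr

/-- The natural choice $\rho=w^2/N$ may vanish, so a small multiple of a Gaussian is mixed in. Then
$\log\rho\ge\log((1-\varepsilon)w^2/N)$ where $w\ne0$, and $\varepsilon\to0$ gives the entropy. -/
theorem integral_cutoff_entropy_le {k : ℝ} (hk : 0 < k) {W W' : ℕ → ℝ → ℝ}
    (hW : ∀ n, IsH1Pair (W n) (W' n)) {P : ℝ → ℝ} (hP : MemLp P 2)
    (hconv : Tendsto (fun n => ∫ x, (W' n x - k * W n x - P x) ^ 2) atTop (𝓝 0))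
    {w : ℝ → ℝ} (hw : Continuous w) {M : ℝ} (hM : ∀ x, |w x| ≤ M)
    (hunif : TendstoUniformly W w atTop) (hwi : Integrable fun x => w x ^ 2) {N : ℝ} (hN : 0 < N)
    (hwN : ∫ x, w x ^ 2 = N) {χ χ' : ℝ → ℝ} (hχ : ∀ x, HasDerivAt χ (χ' x) x) (hχ' : Continuous χ')
    (hsupp : HasCompactSupport χ) (χ1 : ∀ x, χ x ^ 2 ≤ 1) {L : ℝ} (hL : ∀ x, χ' x ^ 2 ≤ L)
    {κ δ : ℝ} (hκ : 0 < κ) (hδ : 0 < δ) :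
    (∫ x, χ x ^ 2 * (w x ^ 2 * Real.log (w x ^ 2))) - Real.log N * ∫ x, χ x ^ 2 * w x ^ 2 ≤
      1 / (2 * κ ^ 2) *
      ((1 + δ) * ((1 + δ) * (∫ x, P x ^ 2) - k ^ 2 * ∫ x, χ x ^ 2 * w x ^ 2) +
        (1 + 1 / δ) * L * ((1 + δ) * (∫ x, P x ^ 2) / k ^ 2)) -
      (Real.log (2 * Real.pi) / 2 + 1 - Real.log (2 * κ)) * ∫ x, χ x ^ 2 * w x ^ 2 := by
  generalize hB : 1 / (2 * κ ^ 2) *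
      ((1 + δ) * ((1 + δ) * (∫ x, P x ^ 2) - k ^ 2 * ∫ x, χ x ^ 2 * w x ^ 2) +
        (1 + 1 / δ) * L * ((1 + δ) * (∫ x, P x ^ 2) / k ^ 2)) -
      (Real.log (2 * Real.pi) / 2 + 1 - Real.log (2 * κ)) * ∫ x, χ x ^ 2 * w x ^ 2 = B
  have χc : Continuous χ := continuous_iff_continuousAt.2 fun x => (hχ x).continuousAt
  set γ : ℝ → ℝ := ProbabilityTheory.gaussianPDFReal 0 1 with hγ
  have γc : Continuous γ := by
    rw [hγ]; unfold ProbabilityTheory.gaussianPDFReal; fun_prop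
  have γpos : ∀ x, 0 < γ x := fun x => ProbabilityTheory.gaussianPDFReal_pos _ _ _ one_ne_zero
  have γi : Integrable γ := ProbabilityTheory.integrable_gaussianPDFReal 0 1
  have γ1 : ∫ x, γ x = 1 := ProbabilityTheory.integral_gaussianPDFReal_eq_one 0 one_ne_zero
  have iY : Integrable fun x => χ x ^ 2 * w x ^ 2 :=
    integrable_sq_cutoff_mul χc hsupp (hw.pow 2)
  have hwl : Continuous fun x => w x ^ 2 * Real.log (w x ^ 2) :=
    Real.continuous_mul_log.comp' (hw.pow 2)
  have iE : Integrable fun x => χ x ^ 2 * (w x ^ 2 * Real.log (w x ^ 2)) :=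
    integrable_sq_cutoff_mul χc hsupp hwl
  have key : ∀ ε ∈ Set.Ioo (0 : ℝ) 1, (∫ x, χ x ^ 2 * (w x ^ 2 * Real.log (w x ^ 2))) +
      (Real.log (1 - ε) - Real.log N) * ∫ x, χ x ^ 2 * w x ^ 2 ≤ B := by
    rintro ε ⟨ε0, ε1⟩
    have ε1' : 0 < 1 - ε := by linarith
    set ρ : ℝ → ℝ := fun x => (1 - ε) / N * w x ^ 2 + ε * γ x with hρ
    have ρc : Continuous ρ := (continuous_const.mul (hw.pow 2)).add (continuous_const.mul γc)
    have ρpos : ∀ x, 0 < ρ x := fun x => by have := γpos x; positivity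
    have ρi : Integrable ρ := (hwi.const_mul _).add (γi.const_mul _)
    have ρ1 : ∫ x, ρ x = 1 := by
      rw [hρ, integral_add (hwi.const_mul _) (γi.const_mul _), integral_const_mul,
        integral_const_mul, hwN, γ1]
      field_simp; ring
    have main := (integral_cutoff_limit_le hk hW hP hconv hM hunif ρc ρpos ρi ρ1 hχ hχ' hsupp
      χ1 hL hκ hδ).2
    rw [hB] at main
    refine le_trans ?_ main
    rw [← integral_const_mul, ← integral_add iE (iY.const_mul _)]
    have iρ : Integrable fun x => χ x ^ 2 * Real.log (ρ x) * w x ^ 2 := by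
      simp_rw [mul_assoc]
      exact integrable_sq_cutoff_mul χc hsupp
        ((ρc.log fun x => (ρpos x).ne').mul (hw.pow 2))
    refine integral_mono (iE.add (iY.const_mul _)) iρ fun x => ?_
    simp only
    rcases eq_or_ne (w x) 0 with h0 | h0
    · simp [h0]
    · have h1 : Real.log ((1 - ε) / N * w x ^ 2) ≤ Real.log (ρ x) := by
        apply Real.log_le_log (by positivity)
        have := (mul_pos ε0 (γpos x)).le
        simp only [hρ]; linarith
      rw [Real.log_mul (by positivity) (by positivity), Real.log_div ε1'.ne' hN.ne'] at h1
      have := mul_le_mul_of_nonneg_left h1 (show 0 ≤ χ x ^ 2 * w x ^ 2 by positivity)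
      linarith
  have t : Tendsto (fun ε : ℝ => (∫ x, χ x ^ 2 * (w x ^ 2 * Real.log (w x ^ 2))) +
      (Real.log (1 - ε) - Real.log N) * ∫ x, χ x ^ 2 * w x ^ 2) (𝓝[>] 0)
      (𝓝 ((∫ x, χ x ^ 2 * (w x ^ 2 * Real.log (w x ^ 2))) +
      (Real.log (1 - 0) - Real.log N) * ∫ x, χ x ^ 2 * w x ^ 2)) := by
    refine Tendsto.mono_left (ContinuousAt.tendsto ?_) nhdsWithin_le_nhds
    have : ContinuousAt (fun ε : ℝ => Real.log (1 - ε)) 0 :=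
      (continuousAt_const.sub continuousAt_id).log (by simp)
    exact continuousAt_const.add ((this.sub continuousAt_const).mul continuousAt_const)
  have := le_of_tendsto t (by
    filter_upwards [Ioo_mem_nhdsGT (zero_lt_one' ℝ)] with ε hε using key ε hε)
  simp only [sub_zero, Real.log_one, zero_sub] at this
  linarith

/-- Logarithmic Sobolev inequality on the line for a limit of `C¹` functions whose twisted
derivatives `W' - k W` converge to `P` in `L²`. -/
theorem entropy_le_of_tendsto_L2 {k : ℝ} (hk : 0 < k) {W W' : ℕ → ℝ → ℝ}
    (hW : ∀ n, IsH1Pair (W n) (W' n)) {P : ℝ → ℝ} (hP : MemLp P 2)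
    (hconv : Tendsto (fun n => ∫ x, (W' n x - k * W n x - P x) ^ 2) atTop (𝓝 0))
    {w : ℝ → ℝ} (hlim : ∀ᵐ x, Tendsto (fun n => W n x) atTop (𝓝 (w x)))
    (hwi : Integrable fun x => w x ^ 2) {N : ℝ} (hN : 0 < N) (hwN : ∫ x, w x ^ 2 = N) :
    (∃ M, ∀ᵐ x, |w x| ≤ M) ∧ 0 < ∫ x, P x ^ 2 ∧
    ((Integrable fun x => w x ^ 2 * Real.log (w x ^ 2)) → ∀ κ > 0,
      (∫ x, w x ^ 2 * Real.log (w x ^ 2)) - Real.log N * N ≤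
        1 / (2 * κ ^ 2) * ((∫ x, P x ^ 2) - k ^ 2 * N) -
        (Real.log (2 * Real.pi) / 2 + 1 - Real.log (2 * κ)) * N) := by
  obtain ⟨v, vc, ⟨M, hM⟩, hunif⟩ := exists_tendstoUniformly_of_tendsto_L2 hk hW hP hconv
  have hwv : w =ᵐ[volume] v := by
    filter_upwards [hlim] with x hx using tendsto_nhds_unique hx (hunif.tendsto_at x)
  have hv2 : (fun x => w x ^ 2) =ᵐ[volume] fun x => v x ^ 2 := by
    filter_upwards [hwv] with x hx; rw [hx]
  have hvl : (fun x => w x ^ 2 * Real.log (w x ^ 2)) =ᵐ[volume]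
      fun x => v x ^ 2 * Real.log (v x ^ 2) := by
    filter_upwards [hwv] with x hx; rw [hx]
  rw [integral_congr_ae hv2] at hwN
  rw [integrable_congr hvl, integral_congr_ae hvl]
  rw [integrable_congr hv2] at hwi
  obtain ⟨χ, χs, χcs, χ0, χ1, χeq, C, hC⟩ := exists_smooth_cutoff
  have χd : ∀ x, HasDerivAt χ (deriv χ x) x := fun x =>
    (χs.differentiable (by simp) x).hasDerivAt
  have χ'c : Continuous (deriv χ) := χs.continuous_deriv (by simp)
  -- The same `t n` serves as inverse width of the cutoff and as Young parameter `δ`: with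
  -- $L=C^2t^2$ the error factor $(1+1/t)L=C^2(t^2+t)$ still tends to zero.
  set t : ℕ → ℝ := fun n => 1 / ((n : ℝ) + 1) with ht
  have tpos : ∀ n, 0 < t n := fun n => by rw [ht]; positivity
  have tlim : Tendsto t atTop (𝓝 0) := tendsto_one_div_add_atTop_nhds_zero_nat
  have hd : ∀ n x, HasDerivAt (fun x => χ (x * t n)) (deriv χ (x * t n) * t n) x := fun n x => by
    have := HasDerivAt.comp x (χd (x * t n)) ((hasDerivAt_id x).mul_const (t n))
    rwa [one_mul] at this
  have hdc : ∀ n, Continuous fun x => deriv χ (x * t n) * t n := fun n =>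
    (χ'c.comp (continuous_id.mul continuous_const)).mul continuous_const
  have hcs : ∀ n, HasCompactSupport fun x => χ (x * t n) := fun n =>
    χcs.comp_homeomorph (Homeomorph.mulRight₀ (t n) (tpos n).ne')
  have hsq1 : ∀ n x, χ (x * t n) ^ 2 ≤ 1 := fun n x => pow_le_one₀ (χ0 _) (χ1 _)
  have hL : ∀ n x, (deriv χ (x * t n) * t n) ^ 2 ≤ C ^ 2 * t n ^ 2 := fun n x => by
    rw [mul_pow]
    gcongr ?_ * _
    rw [← sq_abs]
    exact pow_le_pow_left₀ (abs_nonneg _) (hC _) 2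
  have χlim : ∀ x, Tendsto (fun n => χ (x * t n) ^ 2) atTop (𝓝 1) := fun x => by
    refine tendsto_const_nhds.congr' ?_
    have h0 : Tendsto (fun n => |x * t n|) atTop (𝓝 0) := by
      simpa using (tlim.const_mul x).abs
    filter_upwards [h0.eventually (gt_mem_nhds one_pos)] with n hn
    rw [χeq _ hn.le, one_pow]
  have χc : ∀ n, Continuous fun x => χ (x * t n) := fun n =>
    χs.continuous.comp (continuous_id.mul continuous_const)
  have lim : ∀ f : ℝ → ℝ, Integrable f →
      Tendsto (fun n => ∫ x, χ (x * t n) ^ 2 * f x) atTop (𝓝 (∫ x, f x)) := by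
    intro f hf
    refine tendsto_integral_of_dominated_convergence (fun x => ‖f x‖)
      (fun n => ((χc n).pow 2).aestronglyMeasurable.mul hf.aestronglyMeasurable) hf.norm
      (fun n => Eventually.of_forall fun x => ?_) (Eventually.of_forall fun x => ?_)
    · rw [norm_mul, Real.norm_of_nonneg (sq_nonneg _)]
      exact mul_le_of_le_one_left (norm_nonneg _) (hsq1 n x)
    · simpa using (χlim x).mul_const (f x)
  have limY := lim _ hwi
  rw [hwN] at limY
  refine ⟨⟨M, ?_⟩, ?_, fun hi κ hκ => ?_⟩
  · filter_upwards [hwv] with x hx; rw [hx]; exact hM x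
  · have h1 : k ^ 2 * N ≤ (1 + 1) * ∫ x, P x ^ 2 := by
      refine le_of_tendsto' (limY.const_mul (k ^ 2)) fun n => ?_
      -- Only the Hardy bound is extracted here: the Gaussian and $\kappa=1$ are placeholders, and
      -- the crude $\delta=1$ is enough for positivity.
      exact (integral_cutoff_limit_le hk hW hP hconv hM hunif
        (by unfold ProbabilityTheory.gaussianPDFReal; fun_prop)
        (fun x => ProbabilityTheory.gaussianPDFReal_pos 0 1 x one_ne_zero)
        (ProbabilityTheory.integrable_gaussianPDFReal 0 1)
        (ProbabilityTheory.integral_gaussianPDFReal_eq_one 0 one_ne_zero) (hd n) (hdc n) (hcs n)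
        (hsq1 n) (hL n) one_pos one_pos).1
    have : 0 < k ^ 2 * N := by positivity
    linarith
  · have limE := lim _ hi
    set D := ∫ x, P x ^ 2
    have limR : Tendsto (fun n => 1 / (2 * κ ^ 2) *
      ((1 + t n) * ((1 + t n) * D - k ^ 2 * ∫ x, χ (x * t n) ^ 2 * v x ^ 2) +
        (C ^ 2 * (t n ^ 2 + t n)) * ((1 + t n) * D / k ^ 2)) -
      (Real.log (2 * Real.pi) / 2 + 1 - Real.log (2 * κ)) * ∫ x, χ (x * t n) ^ 2 * v x ^ 2) atTop
      (𝓝 (1 / (2 * κ ^ 2) *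
      ((1 + 0) * ((1 + 0) * D - k ^ 2 * N) +
        (C ^ 2 * (0 ^ 2 + 0)) * ((1 + 0) * D / k ^ 2)) -
      (Real.log (2 * Real.pi) / 2 + 1 - Real.log (2 * κ)) * N)) :=
      (((((tlim.const_add 1).mul (((tlim.const_add 1).mul_const D).sub (limY.const_mul _))).add
        ((((tlim.pow 2).add tlim).const_mul _).mul
          (((tlim.const_add 1).mul_const D).div_const _))).const_mul _).sub (limY.const_mul _))
    have fin := le_of_tendsto_of_tendsto' (limE.sub (limY.const_mul (Real.log N))) limR fun n => by
      have := integral_cutoff_entropy_le hk hW hP hconv vc hM hunif hwi hN hwN (hd n) (hdc n)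
        (hcs n) (hsq1 n) (hL n) hκ (tpos n)
      have e : (1 + 1 / t n) * (C ^ 2 * t n ^ 2) = C ^ 2 * (t n ^ 2 + t n) := by
        have := (tpos n).ne'
        field_simp
      rwa [e] at this
    simpa using fin

/-! ### Logarithmic polar coordinates -/

theorem lintegral_Ioi_eq_lintegral_exp (g : ℝ → ℝ≥0∞) :
    ∫⁻ r in Set.Ioi (0 : ℝ), g r = ∫⁻ s, ENNReal.ofReal (Real.exp s) * g (Real.exp s) := by
  have := lintegral_image_eq_lintegral_abs_deriv_mul (s := Set.univ) MeasurableSet.univ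
    (fun x _ => (Real.hasDerivAt_exp x).hasDerivWithinAt) Real.exp_injective.injOn g
  simpa [Set.image_univ, Real.range_exp, Real.abs_exp] using this

theorem integral_Ioi_eq_integral_exp (g : ℝ → ℝ) :
    ∫ r in Set.Ioi (0 : ℝ), g r = ∫ s, Real.exp s * g (Real.exp s) := by
  have := integral_image_eq_integral_abs_deriv_smul (s := Set.univ) MeasurableSet.univ
    (fun x _ => (Real.hasDerivAt_exp x).hasDerivWithinAt) Real.exp_injective.injOn g
  simpa [Set.image_univ, Real.range_exp, Real.abs_exp] using this

theorem integrableOn_Ioi_iff_integrable_exp (g : ℝ → ℝ) :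
    IntegrableOn g (Set.Ioi (0 : ℝ)) ↔ Integrable fun s => Real.exp s * g (Real.exp s) := by
  have := integrableOn_image_iff_integrableOn_abs_deriv_smul (s := Set.univ) MeasurableSet.univ
    (fun x _ => (Real.hasDerivAt_exp x).hasDerivWithinAt) Real.exp_injective.injOn g
  simpa [Set.image_univ, Real.range_exp, Real.abs_exp] using this

/-- The surface measure of the unit sphere of `ℝᵈ`. -/
noncomputable def sphereArea (d : ℕ) : ℝ :=
  d * volume.real (Metric.ball (0 : EuclideanSpace ℝ (Fin d)) 1)

theorem exp_mul_exp_pow_pred {d : ℕ} (hd : 0 < d) (s : ℝ) :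
    Real.exp s * Real.exp s ^ (d - 1) = Real.exp (d * s) := by
  rw [← Real.exp_nat_mul, ← Real.exp_add, Nat.cast_pred hd]; ring_nf

section

variable {d : ℕ}

theorem sphereArea_pos (hd : 0 < d) : 0 < sphereArea d := by
  have : Nonempty (Fin d) := ⟨⟨0, hd⟩⟩
  have : 0 < volume.real (Metric.ball (0 : EuclideanSpace ℝ (Fin d)) 1) :=
    ENNReal.toReal_pos (Metric.measure_ball_pos volume _ one_pos).ne' measure_ball_lt_top.ne
  unfold sphereArea
  positivity

theorem toSphere_univ_eq (d : ℕ) :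
    (volume : Measure (EuclideanSpace ℝ (Fin d))).toSphere Set.univ =
      ENNReal.ofReal (sphereArea d) := by
  rw [Measure.toSphere_apply_univ, finrank_euclideanSpace_fin, sphereArea,
    ENNReal.ofReal_mul (by positivity), Measure.real, ENNReal.ofReal_toReal measure_ball_lt_top.ne,
    ENNReal.ofReal_natCast]

/-- Integration in logarithmic polar coordinates. -/
theorem lintegral_eq_lintegral_sphere_exp (hd : 0 < d)
    {F : EuclideanSpace ℝ (Fin d) → ℝ≥0∞} (hF : Measurable F) :
    ∫⁻ x, F x = ∫⁻ θ : Metric.sphere (0 : EuclideanSpace ℝ (Fin d)) 1,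
      (∫⁻ s : ℝ, ENNReal.ofReal (Real.exp (d * s)) *
        F (Real.exp s • (θ : EuclideanSpace ℝ (Fin d))))
      ∂(volume : Measure (EuclideanSpace ℝ (Fin d))).toSphere := by
  have : Nonempty (Fin d) := ⟨⟨0, hd⟩⟩
  set μ : Measure (EuclideanSpace ℝ (Fin d)) := volume with hμ
  have e1 : ∫⁻ x, F x ∂μ = ∫⁻ x : ({0}ᶜ : Set (EuclideanSpace ℝ (Fin d))), F x
      ∂(μ.comap Subtype.val) := by
    rw [lintegral_subtype_comap (measurableSet_singleton _).compl, restrict_compl_singleton]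
  have hm : Measurable fun p : Metric.sphere (0 : EuclideanSpace ℝ (Fin d)) 1 × Set.Ioi (0 : ℝ) =>
      F ((p.2 : ℝ) • (p.1 : EuclideanSpace ℝ (Fin d))) := by fun_prop
  have e2 := (Measure.measurePreserving_homeomorphUnitSphereProd μ).lintegral_comp hm
  have e3 : ∀ x : ({0}ᶜ : Set (EuclideanSpace ℝ (Fin d))),
      ((homeomorphUnitSphereProd (EuclideanSpace ℝ (Fin d)) x).2 : ℝ) •
      ((homeomorphUnitSphereProd (EuclideanSpace ℝ (Fin d)) x).1 : EuclideanSpace ℝ (Fin d)) = x := by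
    intro x
    rw [← homeomorphUnitSphereProd_symm_apply_coe, Homeomorph.symm_apply_apply]
  simp_rw [e3] at e2
  rw [e1, e2, lintegral_prod _ hm.aemeasurable]
  refine lintegral_congr fun θ => ?_
  have hθ : Measurable fun r : ℝ => F (r • (θ : EuclideanSpace ℝ (Fin d))) := by fun_prop
  rw [Measure.volumeIoiPow, lintegral_withDensity_eq_lintegral_mul _ (by fun_prop) (by fun_prop)]
  simp only [Pi.mul_apply]
  rw [lintegral_subtype_comap measurableSet_Ioi (fun r : ℝ => ENNReal.ofReal
      (r ^ (Module.finrank ℝ (EuclideanSpace ℝ (Fin d)) - 1)) *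
      F (r • (θ : EuclideanSpace ℝ (Fin d)))), lintegral_Ioi_eq_lintegral_exp]
  refine lintegral_congr fun s => ?_
  rw [← mul_assoc, ← ENNReal.ofReal_mul (Real.exp_pos _).le, finrank_euclideanSpace_fin,
    exp_mul_exp_pow_pred hd]

theorem norm_exp_smul_sphere (θ : Metric.sphere (0 : EuclideanSpace ℝ (Fin d)) 1) (s : ℝ) :
    ‖Real.exp s • (θ : EuclideanSpace ℝ (Fin d))‖ = Real.exp s := by
  rw [norm_smul, norm_eq_of_mem_sphere, mul_one, Real.norm_of_nonneg (Real.exp_pos _).le]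

theorem lintegral_fun_norm_eq_exp (hd : 0 < d) {g : ℝ → ℝ≥0∞} (hg : Measurable g) :
    ∫⁻ x : EuclideanSpace ℝ (Fin d), g ‖x‖ = ENNReal.ofReal (sphereArea d) *
      ∫⁻ s : ℝ, ENNReal.ofReal (Real.exp (d * s)) * g (Real.exp s) := by
  rw [lintegral_eq_lintegral_sphere_exp hd (by fun_prop)]
  simp_rw [norm_exp_smul_sphere]
  rw [lintegral_const, toSphere_univ_eq, mul_comm]

theorem integral_fun_norm_eq_exp (hd : 0 < d) (g : ℝ → ℝ) :
    ∫ x : EuclideanSpace ℝ (Fin d), g ‖x‖ = sphereArea d *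
      ∫ s : ℝ, Real.exp (d * s) * g (Real.exp s) := by
  have : Nonempty (Fin d) := ⟨⟨0, hd⟩⟩
  rw [integral_fun_norm_addHaar, integral_Ioi_eq_integral_exp, finrank_euclideanSpace_fin,
    sphereArea]
  simp_rw [smul_eq_mul, ← mul_assoc, exp_mul_exp_pow_pred hd]
  rw [nsmul_eq_mul, mul_assoc]

theorem integrable_fun_norm_iff_exp (hd : 0 < d) (g : ℝ → ℝ) :
    Integrable (fun x : EuclideanSpace ℝ (Fin d) => g ‖x‖) ↔
      Integrable fun s : ℝ => Real.exp (d * s) * g (Real.exp s) := by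
  have : Nonempty (Fin d) := ⟨⟨0, hd⟩⟩
  rw [integrable_fun_norm_addHaar, integrableOn_Ioi_iff_integrable_exp, finrank_euclideanSpace_fin]
  simp_rw [smul_eq_mul, ← mul_assoc, exp_mul_exp_pow_pred hd]

/-- Tonelli applied to the indicator of a null set; the weight $e^{ds}$ never vanishes, so almost
every ray meets the set in a null set of $s$. -/
theorem ae_sphere_ae_exp (hd : 0 < d) {p : EuclideanSpace ℝ (Fin d) → Prop} (hp : ∀ᵐ x, p x) :
    ∀ᵐ θ : Metric.sphere (0 : EuclideanSpace ℝ (Fin d)) 1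
      ∂(volume : Measure (EuclideanSpace ℝ (Fin d))).toSphere, ∀ᵐ s : ℝ,
      p (Real.exp s • (θ : EuclideanSpace ℝ (Fin d))) := by
  obtain ⟨N, hN, hNm, hN0⟩ := exists_measurable_superset_of_null (ae_iff.1 hp)
  have hm : Measurable (N.indicator (fun _ => (1 : ℝ≥0∞))) := measurable_const.indicator hNm
  have h0 := lintegral_eq_lintegral_sphere_exp hd hm
  rw [lintegral_indicator hNm, lintegral_const, Measure.restrict_apply_univ, hN0, mul_zero] at h0
  have hmm : Measurable fun q : Metric.sphere (0 : EuclideanSpace ℝ (Fin d)) 1 × ℝ =>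
      ENNReal.ofReal (Real.exp (d * q.2)) *
        N.indicator (fun _ => (1 : ℝ≥0∞)) (Real.exp q.2 • (q.1 : EuclideanSpace ℝ (Fin d))) :=
    (by fun_prop : Measurable _).mul (hm.comp (by fun_prop))
  have h1 := (lintegral_eq_zero_iff hmm.lintegral_prod_right').1 h0.symm
  filter_upwards [h1] with θ hθ
  have h2 := (lintegral_eq_zero_iff (hmm.comp measurable_prodMk_left)).1 hθ
  filter_upwards [h2] with s hs
  by_contra hps
  have : Real.exp s • (θ : EuclideanSpace ℝ (Fin d)) ∈ N := hN hps
  simp only [Function.comp_apply, this, Set.indicator_of_mem, mul_one, Pi.zero_apply,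
    ENNReal.ofReal_eq_zero] at hs
  exact hs.not_gt (Real.exp_pos _)

end

/-! ### Reduction of a radial function in $\mathcal D^{1,2}$ to one ray -/

theorem lintegral_enorm_sq_eq {α E : Type*} [MeasurableSpace α] {μ : Measure α}
    [NormedAddCommGroup E] (f : α → E) :
    ∫⁻ x, ‖f x‖ₑ ^ 2 ∂μ = eLpNorm f 2 μ ^ 2 := by
  have := eLpNorm_nnreal_pow_eq_lintegral (f := f) (μ := μ) (p := 2) two_ne_zero
  simpa using this.symm

/-- A sequence of nonnegative functions whose integrals tend to zero has a subsequence tending to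
zero almost everywhere. -/
theorem exists_seq_tendsto_zero_ae_of_lintegral {α : Type*} [MeasurableSpace α] {μ : Measure α}
    {g : ℕ → α → ℝ≥0∞} (hg : ∀ n, Measurable (g n))
    (h : Tendsto (fun n => ∫⁻ x, g n x ∂μ) atTop (𝓝 0)) :
    ∃ ns : ℕ → ℕ, StrictMono ns ∧ ∀ᵐ x ∂μ, Tendsto (fun i => g (ns i) x) atTop (𝓝 0) := by
  have hev : ∀ i : ℕ, ∀ᶠ n in atTop, ∫⁻ x, g n x ∂μ < (2⁻¹ : ℝ≥0∞) ^ i := fun i =>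
    h.eventually (gt_mem_nhds (ENNReal.pow_pos (by simp) i))
  obtain ⟨ns, hns, hlt⟩ := extraction_forall_of_eventually hev
  refine ⟨ns, hns, ?_⟩
  have hsum : ∫⁻ x, ∑' i, g (ns i) x ∂μ ≠ ⊤ := by
    rw [lintegral_tsum fun i => (hg _).aemeasurable]
    refine ne_top_of_le_ne_top ?_ (ENNReal.tsum_le_tsum fun i => (hlt i).le)
    rw [ENNReal.tsum_geometric]
    simp
  filter_upwards [ae_lt_top (Measurable.tsum fun i => hg _) hsum] with x hx
  exact ENNReal.tendsto_atTop_zero_of_tsum_ne_top hx.ne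

section

variable {d : ℕ}

/-- Almost every function in `𝒟^{1,2}` can be approximated along rays: there is a direction along
which test functions and their gradients converge, with at most the average energy. -/
theorem exists_ray_approximation (hd : 3 ≤ d) {u : EuclideanSpace ℝ (Fin d) → ℝ}
    {G : EuclideanSpace ℝ (Fin d) → EuclideanSpace ℝ (Fin d)} (h : HasGradD12 u G) {f : ℝ → ℝ}
    (hu : ∀ᵐ x, u x = f ‖x‖) :
    ∃ (θ : EuclideanSpace ℝ (Fin d)) (φ : ℕ → EuclideanSpace ℝ (Fin d) → ℝ)
      (H : EuclideanSpace ℝ (Fin d) → EuclideanSpace ℝ (Fin d)), ‖θ‖ = 1 ∧ Measurable H ∧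
      (∀ n, ContDiff ℝ ∞ (φ n) ∧ HasCompactSupport (φ n)) ∧
      (∀ᵐ s : ℝ, Tendsto (fun n => φ n (Real.exp s • θ)) atTop (𝓝 (f (Real.exp s)))) ∧
      Tendsto (fun n => ∫⁻ s : ℝ, ENNReal.ofReal (Real.exp (d * s)) *
        ‖gradient (φ n) (Real.exp s • θ) - H (Real.exp s • θ)‖ₑ ^ 2) atTop (𝓝 0) ∧
      ∫⁻ s : ℝ, ENNReal.ofReal (Real.exp (d * s)) * ‖H (Real.exp s • θ)‖ₑ ^ 2 ≤
        (∫⁻ x, ‖G x‖ₑ ^ 2) / ENNReal.ofReal (sphereArea d) := by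
  have hd0 : 0 < d := by lia
  have : Nonempty (Fin d) := ⟨⟨0, hd0⟩⟩
  obtain ⟨hu1, hG, φ, hφ, hφu, hφG⟩ := h
  have hp0 : ENNReal.ofReal (2 * d / (d - 2)) ≠ 0 := by
    have : (3 : ℝ) ≤ d := by exact_mod_cast hd
    rw [Ne, ENNReal.ofReal_eq_zero, not_le]
    exact div_pos (by linarith) (by linarith)
  have hgc : ∀ n, Continuous (gradient (φ n)) := fun n => by
    unfold gradient
    exact (LinearIsometryEquiv.continuous _).comp ((hφ n).1.continuous_fderiv (by simp))
  obtain ⟨ns, hns, hae⟩ := (tendstoInMeasure_of_tendsto_eLpNorm hp0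
    (fun n => (hφ n).1.continuous.aestronglyMeasurable) hu1.1 hφu).exists_seq_tendsto_ae
  -- Restriction to rays requires a genuinely measurable representative of `G`.
  set H := hG.1.mk G with hH
  have Hm : Measurable H := hG.1.stronglyMeasurable_mk.measurable
  have HG : G =ᵐ[volume] H := hG.1.ae_eq_mk
  set g : ℕ → Metric.sphere (0 : EuclideanSpace ℝ (Fin d)) 1 → ℝ≥0∞ := fun n θ =>
    ∫⁻ s : ℝ, ENNReal.ofReal (Real.exp (d * s)) *
      ‖gradient (φ (ns n)) (Real.exp s • (θ : EuclideanSpace ℝ (Fin d))) -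
        H (Real.exp s • (θ : EuclideanSpace ℝ (Fin d)))‖ₑ ^ 2 with hg
  have hFm : ∀ n, Measurable fun x => ‖gradient (φ n) x - H x‖ₑ ^ 2 := fun n =>
    ((hgc n).measurable.sub Hm).enorm.pow_const 2
  have hgm : ∀ n, Measurable (g n) := fun n =>
    Measurable.lintegral_prod_right' (f := fun q : Metric.sphere (0 : EuclideanSpace ℝ (Fin d)) 1 × ℝ =>
      ENNReal.ofReal (Real.exp (d * q.2)) *
      ‖gradient (φ (ns n)) (Real.exp q.2 • (q.1 : EuclideanSpace ℝ (Fin d))) -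
        H (Real.exp q.2 • (q.1 : EuclideanSpace ℝ (Fin d)))‖ₑ ^ 2)
      ((by fun_prop : Measurable _).mul ((hFm (ns n)).comp (by fun_prop)))
  have hgint : ∀ n, ∫⁻ θ, g n θ ∂(volume : Measure (EuclideanSpace ℝ (Fin d))).toSphere =
      eLpNorm (fun x => gradient (φ (ns n)) x - G x) 2 volume ^ 2 := fun n => by
    rw [← lintegral_enorm_sq_eq, hg]
    rw [lintegral_congr_ae (g := fun x => ‖gradient (φ (ns n)) x - H x‖ₑ ^ 2)
      (by filter_upwards [HG] with x hx; rw [hx])]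
    exact (lintegral_eq_lintegral_sphere_exp hd0 (hFm (ns n))).symm
  have hglim : Tendsto (fun n => ∫⁻ θ, g n θ
      ∂(volume : Measure (EuclideanSpace ℝ (Fin d))).toSphere) atTop (𝓝 0) := by
    simp_rw [hgint]
    have := ENNReal.Tendsto.pow (n := 2) (hφG.comp hns.tendsto_atTop)
    simpa using this
  obtain ⟨ms, hms, hgae⟩ := exists_seq_tendsto_zero_ae_of_lintegral hgm hglim
  have huae : ∀ᵐ x, Tendsto (fun i => φ (ns i) x) atTop (𝓝 (f ‖x‖)) := by
    filter_upwards [hae, hu] with x h1 h2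
    rwa [← h2]
  have hall := hgae.and (ae_sphere_ae_exp hd0 huae)
  have hEm : Measurable fun θ : Metric.sphere (0 : EuclideanSpace ℝ (Fin d)) 1 =>
      ∫⁻ s : ℝ, ENNReal.ofReal (Real.exp (d * s)) *
        ‖H (Real.exp s • (θ : EuclideanSpace ℝ (Fin d)))‖ₑ ^ 2 :=
    Measurable.lintegral_prod_right' (f := fun q : Metric.sphere (0 : EuclideanSpace ℝ (Fin d)) 1 × ℝ =>
      ENNReal.ofReal (Real.exp (d * q.2)) *
        ‖H (Real.exp q.2 • (q.1 : EuclideanSpace ℝ (Fin d)))‖ₑ ^ 2)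
      ((by fun_prop : Measurable _).mul ((Hm.enorm.pow_const 2).comp (by fun_prop)))
  -- First moment method: outside the null set of bad directions, some direction has energy at most
  -- the average.
  obtain ⟨θ, hθN, hθ⟩ := exists_notMem_null_le_laverage
    (Measure.toSphere_ne_zero (volume : Measure (EuclideanSpace ℝ (Fin d)))) hEm.aemeasurable
    (ae_iff.1 hall)
  simp only [Set.mem_ofPred_eq, not_not] at hθN
  refine ⟨θ, fun n => φ (ns (ms n)), H, norm_eq_of_mem_sphere θ, Hm, fun n => hφ _, ?_, hθN.1, ?_⟩
  · filter_upwards [hθN.2] with s hs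
    rw [norm_exp_smul_sphere] at hs
    exact hs.comp hms.tendsto_atTop
  · refine hθ.trans_eq ?_
    rw [laverage_eq, toSphere_univ_eq,
      ← lintegral_eq_lintegral_sphere_exp hd0 (Hm.enorm.pow_const 2)]
    congr 1
    exact lintegral_congr_ae (by filter_upwards [HG] with x hx; rw [hx])

/-- The factor $e^{as}$ gives decay as $s\to-\infty$, and the bounded support of $g$ cuts off
$s\to+\infty$. -/
theorem integrable_sq_exp_mul_of_support {a : ℝ} (ha : 0 < a) {g : ℝ → ℝ} (hg : Continuous g)
    {C R : ℝ} (hC : ∀ r, |g r| ≤ C) (hR : ∀ r, R < r → g r = 0) :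
    Integrable fun s => (Real.exp (a * s) * g (Real.exp s)) ^ 2 := by
  set S := Real.log (max R 1)
  have hS : Real.exp S = max R 1 := Real.exp_log (by positivity)
  have hi : Integrable ((Set.Iic S).indicator fun s => Real.exp (2 * a * s) * C ^ 2) :=
    (integrable_indicator_iff measurableSet_Iic).2
      ((integrableOn_exp_mul_Iic (by positivity) S).mul_const _)
  refine hi.mono' ?_ (Eventually.of_forall fun s => ?_)
  · exact (Continuous.aestronglyMeasurable (by fun_prop))
  · rw [Real.norm_of_nonneg (sq_nonneg _)]
    by_cases hs : s ≤ S
    · rw [Set.indicator_of_mem (Set.mem_Iic.2 hs), mul_pow, ← Real.exp_nat_mul, ← sq_abs (g _),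
        show ((2 : ℕ) : ℝ) * (a * s) = 2 * a * s by push_cast; ring]
      gcongr
      exact hC _
    · rw [Set.indicator_of_notMem (by simpa using hs), hR, mul_zero]
      · simp
      · have : Real.exp S < Real.exp s := Real.exp_lt_exp.2 (not_le.1 hs)
        rw [hS] at this
        exact (le_max_left _ _).trans_lt this

/-- Along a ray, a test function becomes an `H¹` function in logarithmic coordinates. -/
theorem isH1Pair_ray {k : ℝ} (hk : 0 < k) {φ : EuclideanSpace ℝ (Fin d) → ℝ} (hφ : ContDiff ℝ ∞ φ)
    (hc : HasCompactSupport φ) {θ : EuclideanSpace ℝ (Fin d)} (hθ : ‖θ‖ = 1) :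
    IsH1Pair (fun s => Real.exp (k * s) * φ (Real.exp s • θ)) (fun s =>
      k * (Real.exp (k * s) * φ (Real.exp s • θ)) +
      Real.exp ((k + 1) * s) * inner ℝ (gradient φ (Real.exp s • θ)) θ) := by
  have hgc : Continuous (gradient φ) := by
    unfold gradient
    exact (LinearIsometryEquiv.continuous _).comp (hφ.continuous_fderiv (by simp))
  have hφc := hφ.continuous
  have hgcs : HasCompactSupport (gradient φ) := by
    unfold gradient
    exact (hc.fderiv (𝕜 := ℝ)).comp_left (map_zero _)
  obtain ⟨C, hC⟩ := hc.exists_bound_of_continuous hφc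
  obtain ⟨C', hC'⟩ := hgcs.exists_bound_of_continuous hgc
  obtain ⟨R, hR⟩ := (hc.isCompact.union hgcs.isCompact).isBounded.subset_closedBall 0
  have hzero : ∀ r : ℝ, R < r → r • θ ∉ tsupport φ ∪ tsupport (gradient φ) := fun r hr hmem => by
    have := hR hmem
    rw [mem_closedBall_zero_iff, norm_smul, hθ, mul_one] at this
    exact absurd ((le_abs_self r).trans this) (not_le.2 hr)
  have i1 := integrable_sq_exp_mul_of_support hk (g := fun r => φ (r • θ)) (by fun_prop)
    (fun r => hC _) (fun r hr => image_eq_zero_of_notMem_tsupport fun hm => hzero r hr (Or.inl hm))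
  have i2 := integrable_sq_exp_mul_of_support (show 0 < k + 1 by linarith)
    (g := fun r => inner ℝ (gradient φ (r • θ)) θ) (C := C') (by fun_prop)
    (fun r => by
      refine (abs_real_inner_le_norm _ _).trans ?_
      rw [hθ, mul_one]; exact hC' _)
    (fun r hr => by
      rw [image_eq_zero_of_notMem_tsupport fun hm => hzero r hr (Or.inr hm), inner_zero_left])
  refine ⟨fun s => ?_, by fun_prop, i1, ?_⟩
  · have h1 : HasDerivAt (fun s : ℝ => Real.exp (k * s)) (Real.exp (k * s) * k) s := by
      simpa using ((hasDerivAt_id s).const_mul k).exp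
    have h2 : HasDerivAt (fun s : ℝ => Real.exp s • θ) (Real.exp s • θ) s :=
      (Real.hasDerivAt_exp s).smul_const θ
    have h3 : HasFDerivAt φ (fderiv ℝ φ (Real.exp s • θ)) (Real.exp s • θ) :=
      (hφ.differentiable (by simp) _).hasFDerivAt
    refine (h1.mul (h3.comp_hasDerivAt s h2)).congr_deriv ?_
    have e : inner ℝ (gradient φ (Real.exp s • θ)) θ = fderiv ℝ φ (Real.exp s • θ) θ := by
      unfold gradient; simp
    rw [e, map_smul, smul_eq_mul, add_mul, Real.exp_add, one_mul, Function.comp_apply]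
    ring
  · refine ((i1.const_mul (2 * k ^ 2)).add (i2.const_mul 2)).mono'
      (Continuous.aestronglyMeasurable (by fun_prop)) (Eventually.of_forall fun s => ?_)
    rw [Real.norm_of_nonneg (sq_nonneg _)]
    simp only [Pi.add_apply]
    nlinarith [sq_nonneg (k * (Real.exp (k * s) * φ (Real.exp s • θ)) -
      Real.exp ((k + 1) * s) * inner ℝ (gradient φ (Real.exp s • θ)) θ)]

/-- Logarithmic Sobolev inequality for the profile of a radial function, in logarithmic
coordinates. -/
theorem radial_entropy_le (hd : 3 ≤ d) {u : EuclideanSpace ℝ (Fin d) → ℝ}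
    {G : EuclideanSpace ℝ (Fin d) → EuclideanSpace ℝ (Fin d)} (h : HasGradD12 u G) {f w : ℝ → ℝ}
    (hu : ∀ᵐ x, u x = f ‖x‖) (hw : ∀ s, w s = Real.exp (((d : ℝ) - 2) / 2 * s) * f (Real.exp s))
    (hwi : Integrable fun x => w x ^ 2) {N : ℝ} (hN : 0 < N) (hwN : ∫ x, w x ^ 2 = N) :
    (∃ M, ∀ᵐ x, |w x| ≤ M) ∧ 0 < ∫ x, ‖G x‖ ^ 2 ∧
    ((Integrable fun x => w x ^ 2 * Real.log (w x ^ 2)) → ∀ κ > 0,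
      (∫ x, w x ^ 2 * Real.log (w x ^ 2)) - Real.log N * N ≤
        1 / (2 * κ ^ 2) * ((∫ x, ‖G x‖ ^ 2) / sphereArea d - (((d : ℝ) - 2) / 2) ^ 2 * N) -
        (Real.log (2 * Real.pi) / 2 + 1 - Real.log (2 * κ)) * N) := by
  have hd3 : (3 : ℝ) ≤ d := by exact_mod_cast hd
  set k : ℝ := ((d : ℝ) - 2) / 2 with hk
  have kpos : 0 < k := by rw [hk]; linarith
  have ω0 := sphereArea_pos (d := d) (by lia)
  obtain ⟨θ, φ, H, hθ, Hm, hφ, hlim, hgrad, hE⟩ := exists_ray_approximation hd h hu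
  set P : ℝ → ℝ := fun s => Real.exp ((k + 1) * s) * inner ℝ (H (Real.exp s • θ)) θ with hPdef
  -- Cauchy–Schwarz with $\|\theta\|=1$; the weights match because $2(k+1)=d$.
  have hexp : ∀ (s : ℝ) (z : EuclideanSpace ℝ (Fin d)),
      ENNReal.ofReal ((Real.exp ((k + 1) * s) * inner ℝ z θ) ^ 2) ≤
        ENNReal.ofReal (Real.exp (d * s)) * ‖z‖ₑ ^ 2 := by
    intro s z
    rw [← ofReal_norm, ← ENNReal.ofReal_pow (norm_nonneg _),
      ← ENNReal.ofReal_mul (Real.exp_pos _).le]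
    refine ENNReal.ofReal_le_ofReal ?_
    rw [mul_pow, ← Real.exp_nat_mul, ← sq_abs (inner ℝ z θ)]
    have e : ((2 : ℕ) : ℝ) * ((k + 1) * s) = d * s := by rw [hk]; push_cast; ring
    rw [e]
    gcongr
    simpa [hθ] using abs_real_inner_le_norm z θ
  have Pm : Measurable P := by
    have : Measurable fun s : ℝ => H (Real.exp s • θ) := Hm.comp (by fun_prop)
    exact (by fun_prop : Measurable fun s : ℝ => Real.exp ((k + 1) * s)).mul
      (this.inner measurable_const)
  have hPl : ∫⁻ s, ENNReal.ofReal (P s ^ 2) ≤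
      (∫⁻ x, ‖G x‖ₑ ^ 2) / ENNReal.ofReal (sphereArea d) :=
    (lintegral_mono fun s => hexp s _).trans hE
  have hGi : Integrable fun x => ‖G x‖ ^ 2 := h.2.1.integrable_norm_pow two_ne_zero
  have hGe : ∫⁻ x, ‖G x‖ₑ ^ 2 = ENNReal.ofReal (∫ x, ‖G x‖ ^ 2) := by
    rw [ofReal_integral_eq_lintegral_ofReal hGi (Eventually.of_forall fun x => sq_nonneg _)]
    refine lintegral_congr fun x => ?_
    rw [← ofReal_norm, ENNReal.ofReal_pow (norm_nonneg _)]
  rw [hGe, ← ENNReal.ofReal_div_of_pos ω0] at hPl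
  have hPi : Integrable fun s => P s ^ 2 := by
    refine ⟨(Pm.pow_const 2).aestronglyMeasurable, ?_⟩
    rw [hasFiniteIntegral_iff_ofReal (Eventually.of_forall fun s => sq_nonneg _)]
    exact hPl.trans_lt ENNReal.ofReal_lt_top
  have hPL : MemLp P 2 := (memLp_two_iff_integrable_sq Pm.aestronglyMeasurable).2 hPi
  have hPD : ∫ s, P s ^ 2 ≤ (∫ x, ‖G x‖ ^ 2) / sphereArea d := by
    rw [← ofReal_integral_eq_lintegral_ofReal hPi (Eventually.of_forall fun s => sq_nonneg _)] at hPl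
    exact (ENNReal.ofReal_le_ofReal_iff (div_nonneg (integral_nonneg fun x => sq_nonneg _)
      ω0.le)).1 hPl
  have hW : ∀ n, IsH1Pair _ _ := fun n => isH1Pair_ray kpos (hφ n).1 (hφ n).2 hθ
  have hconv : Tendsto (fun n => ∫ s, ((k * (Real.exp (k * s) * φ n (Real.exp s • θ)) +
      Real.exp ((k + 1) * s) * inner ℝ (gradient (φ n) (Real.exp s • θ)) θ) -
      k * (Real.exp (k * s) * φ n (Real.exp s • θ)) - P s) ^ 2) atTop (𝓝 0) := by
    have e : ∀ n, ∫ s, ((k * (Real.exp (k * s) * φ n (Real.exp s • θ)) +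
      Real.exp ((k + 1) * s) * inner ℝ (gradient (φ n) (Real.exp s • θ)) θ) -
      k * (Real.exp (k * s) * φ n (Real.exp s • θ)) - P s) ^ 2 =
      (∫⁻ s, ENNReal.ofReal ((Real.exp ((k + 1) * s) * inner ℝ (gradient (φ n) (Real.exp s • θ) -
        H (Real.exp s • θ)) θ) ^ 2)).toReal := by
      intro n
      rw [integral_eq_lintegral_of_nonneg_ae (Eventually.of_forall fun s => sq_nonneg _)]
      · congr 1
        refine lintegral_congr fun s => ?_
        congr 2
        rw [inner_sub_left, hPdef]; ring
      · exact ((((hW n).continuous'.sub (continuous_const.mul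
          (hW n).continuous)).aestronglyMeasurable).sub Pm.aestronglyMeasurable).pow 2
    simp_rw [e]
    rw [← ENNReal.toReal_zero]
    refine (ENNReal.tendsto_toReal ENNReal.zero_ne_top).comp
      (tendsto_of_tendsto_of_tendsto_of_le_of_le tendsto_const_nhds hgrad (fun n => zero_le)
        fun n => lintegral_mono fun s => hexp s _)
  obtain ⟨hb, hpos, hent⟩ := entropy_le_of_tendsto_L2 kpos hW hPL hconv (w := w) (by
    filter_upwards [hlim] with s hs
    rw [hw]
    exact hs.const_mul _) hwi hN hwN
  refine ⟨hb, ?_, fun hi κ hκ => (hent hi κ hκ).trans ?_⟩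
  · have := hpos.trans_le hPD
    exact (div_pos_iff_of_pos_right ω0).1 this
  · gcongr

end

/-! ### The sharp constant and the radial inequality -/

/-- With a finite positive part, either the negative part is infinite and the value is $-\infty$, or
the function is integrable and the Bochner integral applies. -/
theorem extIntegral_le_of_lintegral_lt_top {d : ℕ} {F : EuclideanSpace ℝ (Fin d) → ℝ}
    (hF : AEStronglyMeasurable F) (hpos : ∫⁻ x, ENNReal.ofReal (F x) < ⊤) {c : ℝ}
    (h : Integrable F → ∫ x, F x ≤ c) : extIntegral F ≤ (c : EReal) := by
  unfold extIntegral
  by_cases hneg : ∫⁻ x, ENNReal.ofReal (-F x) = ⊤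
  · rw [hneg, sub_eq_add_neg, EReal.coe_ennreal_top, EReal.neg_top, EReal.add_bot]
    exact bot_le
  · have hi : Integrable F := by
      refine ⟨hF, ?_⟩
      unfold HasFiniteIntegral
      have e : ∀ x, ‖F x‖ₑ ≤ ENNReal.ofReal (F x) + ENNReal.ofReal (-F x) := fun x => by
        rw [← ofReal_norm, Real.norm_eq_abs, abs_eq_max_neg,
          ENNReal.ofReal_max]
        exact max_le le_self_add le_add_self
      refine (lintegral_mono e).trans_lt ?_
      rw [lintegral_add_left' hF.aemeasurable.ennreal_ofReal]
      exact ENNReal.add_lt_top.2 ⟨hpos, lt_top_iff_ne_top.2 hneg⟩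
    have := h hi
    rw [integral_eq_lintegral_pos_part_sub_lintegral_neg_part hi] at this
    rw [← ENNReal.ofReal_toReal hpos.ne, ← ENNReal.ofReal_toReal hneg,
      EReal.coe_ennreal_ofReal, EReal.coe_ennreal_ofReal, max_eq_left ENNReal.toReal_nonneg,
      max_eq_left ENNReal.toReal_nonneg, ← EReal.coe_sub]
    exact EReal.coe_le_coe_iff.2 this

theorem sphereArea_eq {d : ℕ} (hd : 0 < d) :
    sphereArea d = 2 * Real.pi ^ ((d : ℝ) / 2) / Real.Gamma (d / 2) := by
  have : Nonempty (Fin d) := ⟨⟨0, hd⟩⟩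
  have hd0 : (0 : ℝ) < d := by exact_mod_cast hd
  have hG : 0 < Real.Gamma (d / 2) := Real.Gamma_pos_of_pos (by positivity)
  rw [sphereArea, Measure.real, EuclideanSpace.volume_ball, ENNReal.ofReal_one, one_pow, one_mul,
    Fintype.card_fin, Real.Gamma_add_one (by positivity), ENNReal.toReal_ofReal (by positivity),
    Real.sqrt_eq_rpow, ← Real.rpow_natCast, ← Real.rpow_mul Real.pi_pos.le,
    show (1 / 2 : ℝ) * d = d / 2 by ring]
  field_simp

theorem radialLogHardyConst_pos {d : ℕ} (hd : 3 ≤ d) : 0 < radialLogHardyConst d := by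
  have hd3 : (3 : ℝ) ≤ d := by exact_mod_cast hd
  have hG : 0 < Real.Gamma (d / 2) := Real.Gamma_pos_of_pos (by positivity)
  have h1 : (0 : ℝ) < d - 1 := by linarith
  have h2 : (0 : ℝ) < d - 2 := by linarith
  unfold radialLogHardyConst
  positivity

/-- Expands the constant into elementary logarithms, so that both the bound and the equality case
reduce to linear arithmetic in them. -/
theorem half_mul_log_radialLogHardyConst {d : ℕ} (hd : 3 ≤ d) :
    (d : ℝ) / 2 * Real.log (radialLogHardyConst d) =
      d / 2 * (2 * Real.log 2 - Real.log d) - Real.log (sphereArea d) -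
      (Real.log 2 + Real.log Real.pi + 1) / 2 +
      (d - 1) / 2 * (Real.log (d - 1) - 2 * Real.log (d - 2)) := by
  have hd3 : (3 : ℝ) ≤ d := by exact_mod_cast hd
  have hd0 : (0 : ℝ) < d := by linarith
  have hG : 0 < Real.Gamma (d / 2) := Real.Gamma_pos_of_pos (by positivity)
  have h1 : (0 : ℝ) < d - 1 := by linarith
  have h2 : (0 : ℝ) < d - 2 := by linarith
  have hpi := Real.pi_pos
  have l4 : Real.log 4 = 2 * Real.log 2 := by
    rw [show (4 : ℝ) = 2 ^ 2 by norm_num, Real.log_pow]; norm_num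
  have l8 : Real.log 8 = 3 * Real.log 2 := by
    rw [show (8 : ℝ) = 2 ^ 3 by norm_num, Real.log_pow]; norm_num
  rw [sphereArea_eq (by lia), radialLogHardyConst, Real.log_mul (by positivity) (by positivity),
    Real.log_mul (by positivity) (by positivity), Real.log_div (by positivity) (by positivity),
    Real.log_div (by positivity) (by positivity), Real.log_mul (by positivity) (by positivity),
    Real.log_rpow hG, Real.log_rpow (by positivity), Real.log_rpow (by positivity),
    Real.log_mul (by positivity) (by positivity), Real.log_mul (by positivity) (by positivity),
    Real.log_exp, Real.log_div h1.ne' (by positivity), Real.log_pow,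
    Real.log_div (by positivity) hG.ne', Real.log_mul (by positivity) (by positivity),
    Real.log_rpow hpi, l4, l8]
  push_cast
  field_simp
  ring

/-- The integrand of the logarithmic Hardy inequality for a radial function, as a function of the
radius. -/
theorem exp_mul_logHardy {d : ℕ} (f : ℝ → ℝ) (s : ℝ) :
    Real.exp (d * s) * (|f (Real.exp s)| ^ 2 / Real.exp s ^ 2 *
        Real.log (Real.exp s ^ ((d : ℝ) - 2) * |f (Real.exp s)| ^ 2)) =
      (Real.exp (((d : ℝ) - 2) / 2 * s) * f (Real.exp s)) ^ 2 *
        Real.log ((Real.exp (((d : ℝ) - 2) / 2 * s) * f (Real.exp s)) ^ 2) := by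
  have e : Real.exp s ^ ((d : ℝ) - 2) = Real.exp (((d : ℝ) - 2) / 2 * s) ^ 2 := by
    rw [← Real.exp_mul, ← Real.exp_nat_mul]; congr 1; push_cast; ring
  have e2 : Real.exp (d * s) = Real.exp (((d : ℝ) - 2) / 2 * s) ^ 2 * Real.exp s ^ 2 := by
    rw [← Real.exp_nat_mul, ← Real.exp_nat_mul, ← Real.exp_add]; congr 1; push_cast; ring
  rw [e, e2, sq_abs, mul_pow]
  field_simp

theorem exp_mul_hardy {d : ℕ} (f : ℝ → ℝ) (s : ℝ) :
    Real.exp (d * s) * (|f (Real.exp s)| ^ 2 / Real.exp s ^ 2) =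
      (Real.exp (((d : ℝ) - 2) / 2 * s) * f (Real.exp s)) ^ 2 := by
  have e2 : Real.exp (d * s) = Real.exp (((d : ℝ) - 2) / 2 * s) ^ 2 * Real.exp s ^ 2 := by
    rw [← Real.exp_nat_mul, ← Real.exp_nat_mul, ← Real.exp_add]; congr 1; push_cast; ring
  rw [e2, sq_abs, mul_pow]
  field_simp

/-- The choice $\kappa^2=D/d$ agrees with the optimal $\kappa^2=D-k^2$ exactly when
$D=D_*:=d(d-2)^2/(4(d-1))$, the energy of the extremal. The remaining term in $1/D$ is handled by
$\log y\le y-1$ at $y=D_*/D$, again sharp at $D=D_*$. -/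
theorem log_hardy_bound_le {d : ℕ} (hd : 3 ≤ d) {D X : ℝ} (hD : 0 < D)
    (h : ∀ κ > 0, X - Real.log (1 / sphereArea d) * (1 / sphereArea d) ≤
        1 / (2 * κ ^ 2) * (D / sphereArea d - (((d : ℝ) - 2) / 2) ^ 2 * (1 / sphereArea d)) -
        (Real.log (2 * Real.pi) / 2 + 1 - Real.log (2 * κ)) * (1 / sphereArea d)) :
    sphereArea d * X ≤ (d : ℝ) / 2 * Real.log (radialLogHardyConst d * D) := by
  have hd3 : (3 : ℝ) ≤ d := by exact_mod_cast hd
  have hd0 : (0 : ℝ) < d := by linarith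
  have h1 : (0 : ℝ) < d - 1 := by linarith
  have h2 : (0 : ℝ) < d - 2 := by linarith
  have A0 := sphereArea_pos (d := d) (by lia)
  have hc := half_mul_log_radialLogHardyConst hd
  have h := mul_le_mul_of_nonneg_left (h (√(D / d)) (by positivity)) A0.le
  set A := sphereArea d
  rw [Real.log_mul (radialLogHardyConst_pos hd).ne' hD.ne', mul_add, hc]
  rw [Real.sq_sqrt (by positivity), Real.log_mul two_ne_zero Real.pi_pos.ne',
    Real.log_mul two_ne_zero (show √(D / d) ≠ 0 by positivity), Real.log_sqrt (by positivity),
    Real.log_div hD.ne' hd0.ne', Real.log_div one_ne_zero A0.ne', Real.log_one, zero_sub] at h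
  have e : A * (1 / (2 * (D / d)) * (D / A - (((d : ℝ) - 2) / 2) ^ 2 * (1 / A)) -
      ((Real.log 2 + Real.log Real.pi) / 2 + 1 -
        (Real.log 2 + (Real.log D - Real.log d) / 2)) * (1 / A)) =
      d / 2 - (d - 1) / 2 * (d * (d - 2) ^ 2 / (4 * D * (d - 1))) -
      ((Real.log 2 + Real.log Real.pi) / 2 + 1 -
        (Real.log 2 + (Real.log D - Real.log d) / 2)) := by
    field_simp; ring
  have e' : A * (X - -Real.log A * (1 / A)) = A * X + Real.log A := by field_simp; ring
  rw [e, e'] at h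
  have hx : 0 < d * ((d : ℝ) - 2) ^ 2 / (4 * D * (d - 1)) := by positivity
  have hl := Real.log_le_sub_one_of_pos hx
  have l4 : Real.log 4 = 2 * Real.log 2 := by
    rw [show (4 : ℝ) = 2 ^ 2 by norm_num, Real.log_pow]; norm_num
  have el : Real.log (d * ((d : ℝ) - 2) ^ 2 / (4 * D * (d - 1))) =
      Real.log d + 2 * Real.log (d - 2) - (2 * Real.log 2 + Real.log D + Real.log (d - 1)) := by
    rw [Real.log_div (by positivity) (by positivity), Real.log_mul (by positivity) (by positivity),
      Real.log_mul (by positivity) (by positivity), Real.log_mul (by positivity) (by positivity),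
      Real.log_pow, l4]
    push_cast; ring
  rw [el] at hl
  have hl2 := mul_le_mul_of_nonneg_left hl (show (0 : ℝ) ≤ (d - 1) / 2 by linarith)
  linarith

/-- The logarithmic Hardy inequality for radial functions. -/
theorem radial_log_hardy {d : ℕ} (hd : 3 ≤ d) {u : EuclideanSpace ℝ (Fin d) → ℝ}
    {G : EuclideanSpace ℝ (Fin d) → EuclideanSpace ℝ (Fin d)} (h : HasGradD12 u G)
    (hrad : IsRadialAE u) (h1 : ∫ x, |u x| ^ 2 / ‖x‖ ^ 2 = 1) :
    (∫⁻ x, ENNReal.ofReal (logHardyIntegrand u x) < ⊤) ∧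
      extIntegral (logHardyIntegrand u) ≤
        (((d : ℝ) / 2 * Real.log (radialLogHardyConst d * ∫ x, ‖G x‖ ^ 2) : ℝ) : EReal) := by
  have hd0 : 0 < d := by lia
  have A0 := sphereArea_pos hd0
  obtain ⟨f, fm, hu⟩ := hrad
  set w : ℝ → ℝ := fun s => Real.exp (((d : ℝ) - 2) / 2 * s) * f (Real.exp s) with hw
  have wm : Measurable w := by fun_prop
  set g : ℝ → ℝ := fun r => |f r| ^ 2 / r ^ 2 * Real.log (r ^ ((d : ℝ) - 2) * |f r| ^ 2) with hg
  have gm : Measurable g := by fun_prop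
  have hgw : ∀ s, Real.exp (d * s) * g (Real.exp s) = w s ^ 2 * Real.log (w s ^ 2) := fun s =>
    exp_mul_logHardy f s
  have hug : logHardyIntegrand u =ᵐ[volume] fun x => g ‖x‖ := by
    filter_upwards [hu] with x hx
    rw [logHardyIntegrand, hx]
  have h1' : ∫ x : EuclideanSpace ℝ (Fin d), |f ‖x‖| ^ 2 / ‖x‖ ^ 2 = 1 := by
    rw [← h1]
    exact integral_congr_ae (by filter_upwards [hu] with x hx; rw [hx])
  -- The Bochner integral of a non-integrable function is 0, so the normalization to 1 forces
  -- integrability.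
  have hi0 : Integrable fun x : EuclideanSpace ℝ (Fin d) => |f ‖x‖| ^ 2 / ‖x‖ ^ 2 :=
    Integrable.of_integral_ne_zero (by rw [h1']; exact one_ne_zero)
  rw [integrable_fun_norm_iff_exp hd0 (fun r => |f r| ^ 2 / r ^ 2)] at hi0
  rw [integral_fun_norm_eq_exp hd0 (fun r => |f r| ^ 2 / r ^ 2)] at h1'
  simp_rw [exp_mul_hardy] at hi0 h1'
  have hN : ∫ s, w s ^ 2 = 1 / sphereArea d := by
    rw [eq_div_iff A0.ne', mul_comm]; exact h1'
  obtain ⟨⟨M, hM⟩, hD, hent⟩ := radial_entropy_le hd h hu (fun s => rfl) hi0 (by positivity) hN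
  have hpos : ∫⁻ x, ENNReal.ofReal (logHardyIntegrand u x) < ⊤ := by
    rw [lintegral_congr_ae (g := fun x => ENNReal.ofReal (g ‖x‖))
      (by filter_upwards [hug] with x hx; rw [hx]),
      lintegral_fun_norm_eq_exp hd0 (g := fun r => ENNReal.ofReal (g r)) (by fun_prop)]
    refine ENNReal.mul_lt_top ENNReal.ofReal_lt_top ?_
    -- Boundedness of $w$ gives $w^2\log w^2\le w^2\log(M^2+1)$, which is integrable.
    have hb : Integrable fun s => w s ^ 2 * Real.log (M ^ 2 + 1) := hi0.mul_const _
    refine lt_of_le_of_lt (lintegral_mono_ae ?_) hb.lintegral_lt_top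
    filter_upwards [hM] with s hs
    rw [← ENNReal.ofReal_mul (Real.exp_pos _).le, hgw]
    refine ENNReal.ofReal_le_ofReal ?_
    rcases eq_or_ne (w s) 0 with h0 | h0
    · simp [h0]
    · refine mul_le_mul_of_nonneg_left (Real.log_le_log (by positivity) ?_) (sq_nonneg _)
      have := pow_le_pow_left₀ (abs_nonneg _) hs 2
      rw [sq_abs] at this
      linarith
  refine ⟨hpos, extIntegral_le_of_lintegral_lt_top ?_ hpos fun hi => ?_⟩
  · exact AEStronglyMeasurable.congr
      (Measurable.aestronglyMeasurable (by fun_prop : Measurable fun x => g ‖x‖)) hug.symm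
  · rw [integrable_congr hug, integrable_fun_norm_iff_exp hd0] at hi
    rw [integral_congr_ae hug, integral_fun_norm_eq_exp hd0]
    simp_rw [hgw] at hi ⊢
    exact log_hardy_bound_le hd hD (hent hi)

/-! ### Radial functions in $\mathcal D^{1,2}$ by truncation in $\log|x|$ -/

/-- The radial function `x ↦ V (log ‖x‖)`, extended by zero at the origin. -/
noncomputable def logRadial {d : ℕ} (V : ℝ → ℝ) (x : EuclideanSpace ℝ (Fin d)) : ℝ :=
  open scoped Classical in if x = 0 then 0 else V (Real.log ‖x‖)

section

variable {d : ℕ} {V V' : ℝ → ℝ}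

theorem logRadial_of_ne_zero {x : EuclideanSpace ℝ (Fin d)} (hx : x ≠ 0) :
    logRadial V x = V (Real.log ‖x‖) := by
  simp [logRadial, hx]

theorem logRadial_eventuallyEq {x : EuclideanSpace ℝ (Fin d)} (hx : x ≠ 0) :
    logRadial V =ᶠ[𝓝 x] fun y => V (Real.log ‖y‖) := by
  filter_upwards [isOpen_ne.mem_nhds hx] with y hy using logRadial_of_ne_zero hy

theorem contDiff_logRadial (hV : ContDiff ℝ ∞ V) (hc : HasCompactSupport V) :
    ContDiff ℝ ∞ (logRadial V : EuclideanSpace ℝ (Fin d) → ℝ) ∧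
      HasCompactSupport (logRadial V : EuclideanSpace ℝ (Fin d) → ℝ) := by
  obtain ⟨R, hR⟩ := hc.isCompact.isBounded.subset_closedBall 0
  have hzero : ∀ s, R < |s| → V s = 0 := fun s hs =>
    image_eq_zero_of_notMem_tsupport fun hm => by
      have := hR hm
      rw [mem_closedBall_zero_iff, Real.norm_eq_abs] at this
      exact hs.not_ge this
  constructor
  · rw [contDiff_iff_contDiffAt]
    intro x
    rcases eq_or_ne x 0 with rfl | hx
    -- Near the origin $\log\|y\|$ lies below the support of `V`, so the function vanishes there and
    -- no singularity remains.
    · have : (logRadial V : EuclideanSpace ℝ (Fin d) → ℝ) =ᶠ[𝓝 0] fun _ => 0 := by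
        filter_upwards [Metric.ball_mem_nhds (0 : EuclideanSpace ℝ (Fin d))
          (Real.exp_pos (-|R|))] with y hy
        rcases eq_or_ne y 0 with rfl | hy0
        · simp [logRadial]
        · rw [logRadial_of_ne_zero hy0]
          refine hzero _ ?_
          rw [mem_ball_zero_iff] at hy
          have h1 : Real.log ‖y‖ < -|R| := by
            rw [← Real.log_exp (-|R|)]
            exact Real.log_lt_log (norm_pos_iff.2 hy0) hy
          have h2 := neg_le_abs (Real.log ‖y‖)
          have h3 := le_abs_self R
          linarith
      exact contDiffAt_const.congr_of_eventuallyEq this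
    · refine ContDiffAt.congr_of_eventuallyEq ?_ (logRadial_eventuallyEq hx)
      exact hV.contDiffAt.comp x ((contDiffAt_norm ℝ hx).log (norm_ne_zero_iff.2 hx))
  · refine HasCompactSupport.intro (isCompact_closedBall 0 (Real.exp |R|)) fun x hx => ?_
    rw [mem_closedBall_zero_iff, not_le] at hx
    have hx0 : x ≠ 0 := norm_pos_iff.1 ((Real.exp_pos _).trans hx)
    rw [logRadial_of_ne_zero hx0]
    refine hzero _ ?_
    have h1 : |R| < Real.log ‖x‖ := by
      rw [← Real.log_exp |R|]
      exact Real.log_lt_log (Real.exp_pos _) hx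
    have h2 := le_abs_self (Real.log ‖x‖)
    have h3 := le_abs_self R
    linarith

theorem gradient_logRadial (hV : ∀ s, HasDerivAt V (V' s) s) {x : EuclideanSpace ℝ (Fin d)}
    (hx : x ≠ 0) : gradient (logRadial V) x = (V' (Real.log ‖x‖) / ‖x‖ ^ 2) • x := by
  have hn : ‖x‖ ≠ 0 := norm_ne_zero_iff.2 hx
  have h1 : HasFDerivAt (fun y : EuclideanSpace ℝ (Fin d) => ‖y‖ ^ 2) (2 • innerSL ℝ x) x :=
    (hasStrictFDerivAt_norm_sq x).hasFDerivAt
  have h2 := h1.log (pow_ne_zero 2 hn)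
  have h3 : HasFDerivAt (fun y : EuclideanSpace ℝ (Fin d) => Real.log ‖y‖)
      ((1 / 2 : ℝ) • ((‖x‖ ^ 2)⁻¹ • (2 • innerSL ℝ x))) x := by
    refine (h2.const_mul (1 / 2)).congr_of_eventuallyEq (Eventually.of_forall fun y => ?_)
    simp only [Real.log_pow]; push_cast; ring
  have h4 := (hV (Real.log ‖x‖)).comp_hasFDerivAt x h3
  have h5 := h4.congr_of_eventuallyEq (logRadial_eventuallyEq hx)
  refine HasGradientAt.gradient ?_
  rw [hasGradientAt_iff_hasFDerivAt]
  refine h5.congr_fderiv ?_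
  ext y
  simp
  field_simp

theorem norm_div_sq_smul_self (a : ℝ) (x : EuclideanSpace ℝ (Fin d)) :
    ‖(a / ‖x‖ ^ 2) • x‖ = |a| / ‖x‖ := by
  rcases eq_or_ne x 0 with rfl | hx
  · simp
  · have hn : ‖x‖ ≠ 0 := norm_ne_zero_iff.2 hx
    rw [norm_smul, Real.norm_eq_abs, abs_div, abs_of_nonneg (sq_nonneg ‖x‖)]
    field_simp

end

theorem tendsto_eLpNorm_zero_of_dominated {α E : Type*} [MeasurableSpace α] {μ : Measure α}
    [NormedAddCommGroup E] {p : ℝ≥0∞} (hp0 : p ≠ 0) (hp : p ≠ ⊤) {f : ℕ → α → E} {g : α → ℝ}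
    (hf : ∀ n, AEStronglyMeasurable (f n) μ) (hg : MemLp g p μ)
    (hb : ∀ n, ∀ᵐ x ∂μ, ‖f n x‖ ≤ g x)
    (hlim : ∀ᵐ x ∂μ, Tendsto (fun n => f n x) atTop (𝓝 0)) :
    Tendsto (fun n => eLpNorm (f n) p μ) atTop (𝓝 0) := by
  have hpp : 0 < p.toReal := ENNReal.toReal_pos hp0 hp
  have h1 : Tendsto (fun n => ∫⁻ x, ‖f n x‖ₑ ^ p.toReal ∂μ) atTop (𝓝 (∫⁻ _, 0 ∂μ)) := by
    refine tendsto_lintegral_of_dominated_convergence' (fun x => ‖g x‖ₑ ^ p.toReal)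
      (fun n => (hf n).enorm.pow_const _) (fun n => ?_) ?_ ?_
    · filter_upwards [hb n] with x hx
      refine ENNReal.rpow_le_rpow (enorm_le_iff_norm_le.2 (hx.trans (le_abs_self _))) hpp.le
    · exact (lintegral_rpow_enorm_lt_top_of_eLpNorm_lt_top hp0 hp hg.2).ne
    · filter_upwards [hlim] with x hx
      have := (ENNReal.continuous_rpow_const (y := p.toReal)).tendsto _ |>.comp
        ((continuous_enorm.tendsto _).comp hx)
      simpa [hpp, Function.comp_def] using this
  simp_rw [eLpNorm_eq_lintegral_rpow_enorm_toReal hp0 hp]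
  have := (ENNReal.continuous_rpow_const (y := 1 / p.toReal)).tendsto _ |>.comp h1
  simpa [hpp, Function.comp_def] using this

/-- A radial function `V (log ‖x‖)` with finite norms belongs to `𝒟^{1,2}`. -/
theorem hasGradD12_logRadial {d : ℕ} (hd : 3 ≤ d) {V V' : ℝ → ℝ} (hV : ContDiff ℝ ∞ V)
    (hV' : ∀ s, HasDerivAt V (V' s) s) {u : EuclideanSpace ℝ (Fin d) → ℝ}
    (hu : ∀ x, x ≠ 0 → u x = V (Real.log ‖x‖))
    (h1 : Integrable fun s => Real.exp (d * s) * |V s| ^ (2 * (d : ℝ) / (d - 2)))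
    (h2 : Integrable fun s => Real.exp (((d : ℝ) - 2) * s) * V s ^ 2)
    (h3 : Integrable fun s => Real.exp (((d : ℝ) - 2) * s) * V' s ^ 2) :
    HasGradD12 u fun x => (V' (Real.log ‖x‖) / ‖x‖ ^ 2) • x := by
  have hd0 : 0 < d := by lia
  have : Nonempty (Fin d) := ⟨⟨0, hd0⟩⟩
  have hd3 : (3 : ℝ) ≤ d := by exact_mod_cast hd
  have hpp : 0 < 2 * (d : ℝ) / (d - 2) := div_pos (by linarith) (by linarith)
  have hp0 : ENNReal.ofReal (2 * d / (d - 2)) ≠ 0 := by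
    rwa [Ne, ENNReal.ofReal_eq_zero, not_le]
  have hp1 : ENNReal.ofReal (2 * d / (d - 2)) ≠ ⊤ := ENNReal.ofReal_ne_top
  have V'eq : V' = deriv V := funext fun s => (hV' s).deriv.symm
  have V'c : Continuous V' := V'eq ▸ hV.continuous_deriv (by simp)
  have Vc := hV.continuous
  have ne0 : ∀ᵐ x : EuclideanSpace ℝ (Fin d), x ≠ 0 := by
    simp [ae_iff]
  have Lm : Measurable fun x : EuclideanSpace ℝ (Fin d) => V (Real.log ‖x‖) := by fun_prop
  have hue : u =ᵐ[volume] fun x => V (Real.log ‖x‖) := by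
    filter_upwards [ne0] with x hx using hu x hx
  have um : AEStronglyMeasurable u := Lm.aestronglyMeasurable.congr hue.symm
  have Gm : Measurable fun x : EuclideanSpace ℝ (Fin d) => (V' (Real.log ‖x‖) / ‖x‖ ^ 2) • x := by
    fun_prop
  have m1 : MemLp (fun x : EuclideanSpace ℝ (Fin d) => V (Real.log ‖x‖))
      (ENNReal.ofReal (2 * d / (d - 2))) := by
    rw [← integrable_norm_rpow_iff Lm.aestronglyMeasurable hp0 hp1,
      ENNReal.toReal_ofReal hpp.le,
      integrable_fun_norm_iff_exp hd0 fun r => ‖V (Real.log r)‖ ^ (2 * (d : ℝ) / (d - 2))]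
    simpa only [Real.log_exp, Real.norm_eq_abs] using h1
  have hm2 : ∀ f : ℝ → ℝ, Continuous f →
      (Integrable fun s => Real.exp (((d : ℝ) - 2) * s) * f s ^ 2) →
      MemLp (fun x : EuclideanSpace ℝ (Fin d) => |f (Real.log ‖x‖)| / ‖x‖) 2 := by
    intro f hf hfi
    rw [memLp_two_iff_integrable_sq
      (Measurable.aestronglyMeasurable (by fun_prop)),
      integrable_fun_norm_iff_exp hd0 fun r => (|f (Real.log r)| / r) ^ 2]
    refine hfi.congr (Eventually.of_forall fun s => ?_)
    simp only [Real.log_exp, div_pow, sq_abs]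
    have : Real.exp (d * s) = Real.exp (((d : ℝ) - 2) * s) * Real.exp s ^ 2 := by
      rw [← Real.exp_nat_mul, ← Real.exp_add]; congr 1; push_cast; ring
    rw [this]
    field_simp
  have mV := hm2 V Vc h2
  have mV' := hm2 V' V'c h3
  have mG : MemLp (fun x : EuclideanSpace ℝ (Fin d) => (V' (Real.log ‖x‖) / ‖x‖ ^ 2) • x) 2 := by
    refine mV'.of_le Gm.aestronglyMeasurable (Eventually.of_forall fun x => ?_)
    rw [norm_div_sq_smul_self]
    exact le_abs_self _
  obtain ⟨χ, χs, χcs, χ0, χ1, χeq, C, hC⟩ := exists_smooth_cutoff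
  have C0 : 0 ≤ C := (abs_nonneg _).trans (hC 0)
  have χd : ∀ x, HasDerivAt χ (deriv χ x) x := fun x =>
    (χs.differentiable (by simp) x).hasDerivAt
  set t : ℕ → ℝ := fun n => 1 / ((n : ℝ) + 1) with ht
  have tpos : ∀ n, 0 < t n := fun n => by rw [ht]; positivity
  have tle : ∀ n, t n ≤ 1 := fun n => by
    rw [ht]; exact div_le_one_of_le₀ (by linarith [n.cast_nonneg (α := ℝ)]) (by positivity)
  have tlim : Tendsto t atTop (𝓝 0) := tendsto_one_div_add_atTop_nhds_zero_nat
  have χt : ∀ s, ∀ᶠ n in atTop, χ (s * t n) = 1 := fun s => by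
    have h0 : Tendsto (fun n => |s * t n|) atTop (𝓝 0) := by
      simpa using (tlim.const_mul s).abs
    filter_upwards [h0.eventually (gt_mem_nhds one_pos)] with n hn
    exact χeq _ hn.le
  -- Cutting off in $s$ removes neighbourhoods of both the origin and infinity. The gradient error
  -- has size $|t\chi'V+(\chi-1)V'|/|x|$, dominated by $(C|V|+|V'|)/|x|$, which is in $L^2$ by `h2`
  -- and `h3`.
  set Vn : ℕ → ℝ → ℝ := fun n s => χ (s * t n) * V s with hVn
  set Vn' : ℕ → ℝ → ℝ := fun n s => deriv χ (s * t n) * t n * V s + χ (s * t n) * V' s with hVn'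
  have hVd : ∀ n s, HasDerivAt (Vn n) (Vn' n s) s := fun n s => by
    have h := HasDerivAt.comp s (χd (s * t n)) ((hasDerivAt_id s).mul_const (t n))
    rw [one_mul] at h
    exact h.mul (hV' s)
  have hVs : ∀ n, ContDiff ℝ ∞ (Vn n) := fun n =>
    (χs.comp (contDiff_id.mul contDiff_const)).mul hV
  have hVcs : ∀ n, HasCompactSupport (Vn n) := fun n =>
    (χcs.comp_homeomorph (Homeomorph.mulRight₀ (t n) (tpos n).ne')).mul_right (f' := V)
  have hφ : ∀ n, ContDiff ℝ ∞ (logRadial (Vn n) : EuclideanSpace ℝ (Fin d) → ℝ) ∧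
      HasCompactSupport (logRadial (Vn n) : EuclideanSpace ℝ (Fin d) → ℝ) := fun n =>
    contDiff_logRadial (hVs n) (hVcs n)
  refine ⟨m1.ae_eq hue.symm, mG, fun n => logRadial (Vn n), hφ, ?_, ?_⟩
  · refine tendsto_eLpNorm_zero_of_dominated hp0 hp1
      (fun n => (hφ n).1.continuous.aestronglyMeasurable.sub um) m1.norm (fun n => ?_) ?_
    · filter_upwards [ne0] with x hx
      rw [logRadial_of_ne_zero hx, hu x hx, hVn, ← sub_one_mul, norm_mul]
      refine mul_le_of_le_one_left (norm_nonneg _) ?_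
      rw [Real.norm_eq_abs, abs_le]
      constructor <;> linarith [χ0 (Real.log ‖x‖ * t n), χ1 (Real.log ‖x‖ * t n)]
    · filter_upwards [ne0] with x hx
      refine tendsto_const_nhds.congr' ?_
      filter_upwards [χt (Real.log ‖x‖)] with n hn
      rw [logRadial_of_ne_zero hx, hu x hx, hVn]
      simp [hn]
  · have hgc : ∀ n, Continuous (gradient (logRadial (Vn n) : EuclideanSpace ℝ (Fin d) → ℝ)) :=
      fun n => by
        unfold gradient
        exact (LinearIsometryEquiv.continuous _).comp ((hφ n).1.continuous_fderiv (by simp))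
    refine tendsto_eLpNorm_zero_of_dominated two_ne_zero ENNReal.ofNat_ne_top
      (fun n => (hgc n).aestronglyMeasurable.sub Gm.aestronglyMeasurable)
      ((mV.const_mul C).add mV') (fun n => ?_) ?_
    · filter_upwards [ne0] with x hx
      have hn : 0 < ‖x‖ := norm_pos_iff.2 hx
      rw [gradient_logRadial (hVd n) hx, ← sub_smul, ← sub_div, norm_div_sq_smul_self]
      simp only [Pi.add_apply]
      rw [← mul_div_assoc, ← add_div]
      refine div_le_div_of_nonneg_right ?_ hn.le
      generalize Real.log ‖x‖ = s
      have e : Vn' n s - V' s = deriv χ (s * t n) * t n * V s + (χ (s * t n) - 1) * V' s := by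
        rw [hVn']; ring
      rw [e]
      refine (abs_add_le _ _).trans ?_
      rw [abs_mul, abs_mul, abs_mul, abs_of_pos (tpos n)]
      refine add_le_add (mul_le_mul_of_nonneg_right ?_ (abs_nonneg _))
        (mul_le_of_le_one_left (abs_nonneg _) ?_)
      · calc |deriv χ (s * t n)| * t n ≤ C * 1 := by
              have := hC (s * t n)
              have := tle n
              have := (tpos n).le
              gcongr
          _ = C := mul_one C
      · rw [abs_le]
        constructor <;> linarith [χ0 (s * t n), χ1 (s * t n)]
    · filter_upwards [ne0] with x hx
      have hl : Tendsto (fun n => ((Vn' n (Real.log ‖x‖) - V' (Real.log ‖x‖)) / ‖x‖ ^ 2) • x) atTop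
          (𝓝 (((0 : ℝ) / ‖x‖ ^ 2) • x)) := by
        refine Tendsto.smul_const (Tendsto.div_const ?_ _) _
        generalize Real.log ‖x‖ = s
        have hz : Tendsto (fun n => C * t n * |V s|) atTop (𝓝 0) := by
          simpa using (tlim.const_mul C).mul_const |V s|
        refine squeeze_zero_norm' ?_ hz
        filter_upwards [χt s] with n hn
        rw [hVn']
        simp only [hn, one_mul, add_sub_cancel_right]
        rw [norm_mul, norm_mul, Real.norm_eq_abs, Real.norm_eq_abs, Real.norm_eq_abs,
          abs_of_pos (tpos n)]
        have := hC (s * t n)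
        have := (tpos n).le
        gcongr
      rw [zero_div, zero_smul] at hl
      refine hl.congr fun n => ?_
      rw [gradient_logRadial (hVd n) hx, ← sub_smul, ← sub_div]

/-! ### Gaussian integrals and the extremal function -/

theorem integrable_sq_mul_exp_neg_mul_sq {β : ℝ} (hβ : 0 < β) :
    Integrable fun s : ℝ => s ^ 2 * Real.exp (-β * s ^ 2) := by
  have := integrable_rpow_mul_exp_neg_mul_sq hβ (s := 2) (by norm_num)
  simpa using this

theorem integral_mul_exp_neg_mul_sq_eq_zero {β : ℝ} (hβ : 0 < β) :
    ∫ s : ℝ, s * Real.exp (-β * s ^ 2) = 0 := by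
  have hd : ∀ s : ℝ, HasDerivAt (fun s : ℝ => Real.exp (-β * s ^ 2))
      (-(2 * β) * (s * Real.exp (-β * s ^ 2))) s := fun s => by
    refine (((hasDerivAt_pow 2 s).const_mul (-β)).exp).congr_deriv ?_
    push_cast; ring
  have := integral_eq_zero_of_hasDerivAt_of_integrable hd
    ((integrable_mul_exp_neg_mul_sq hβ).const_mul _) (integrable_exp_neg_mul_sq hβ)
  rw [integral_const_mul] at this
  exact (mul_eq_zero.1 this).resolve_left (by simp [hβ.ne'])

/-- Integration of the exact derivative of $s\,e^{-\beta s^2}$. -/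
theorem integral_sq_mul_exp_neg_mul_sq {β : ℝ} (hβ : 0 < β) :
    ∫ s : ℝ, s ^ 2 * Real.exp (-β * s ^ 2) = (∫ s : ℝ, Real.exp (-β * s ^ 2)) / (2 * β) := by
  have hd : ∀ s : ℝ, HasDerivAt (fun s : ℝ => s * Real.exp (-β * s ^ 2))
      (Real.exp (-β * s ^ 2) - 2 * β * (s ^ 2 * Real.exp (-β * s ^ 2))) s := fun s => by
    refine ((hasDerivAt_id s).mul ((hasDerivAt_pow 2 s).const_mul (-β)).exp).congr_deriv ?_
    simp only [id]; push_cast; ring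
  have := integral_eq_zero_of_hasDerivAt_of_integrable hd
    ((integrable_exp_neg_mul_sq hβ).sub ((integrable_sq_mul_exp_neg_mul_sq hβ).const_mul _))
    (integrable_mul_exp_neg_mul_sq hβ)
  rw [integral_sub (integrable_exp_neg_mul_sq hβ)
    ((integrable_sq_mul_exp_neg_mul_sq hβ).const_mul _), integral_const_mul] at this
  rw [eq_div_iff (by positivity)]
  linarith

theorem integral_quadratic_mul_exp_neg_mul_sq {β : ℝ} (hβ : 0 < β) (a₀ a₁ a₂ : ℝ) :
    (Integrable fun s : ℝ => (a₀ + a₁ * s + a₂ * s ^ 2) * Real.exp (-β * s ^ 2)) ∧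
    ∫ s : ℝ, (a₀ + a₁ * s + a₂ * s ^ 2) * Real.exp (-β * s ^ 2) =
      (a₀ + a₂ / (2 * β)) * √(Real.pi / β) := by
  have i0 := (integrable_exp_neg_mul_sq hβ).const_mul a₀
  have i1 := (integrable_mul_exp_neg_mul_sq hβ).const_mul a₁
  have i2 := (integrable_sq_mul_exp_neg_mul_sq hβ).const_mul a₂
  have e : ∀ s : ℝ, (a₀ + a₁ * s + a₂ * s ^ 2) * Real.exp (-β * s ^ 2) =
      a₀ * Real.exp (-β * s ^ 2) + a₁ * (s * Real.exp (-β * s ^ 2)) +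
        a₂ * (s ^ 2 * Real.exp (-β * s ^ 2)) := fun s => by ring
  have i01 : Integrable fun s : ℝ =>
      a₀ * Real.exp (-β * s ^ 2) + a₁ * (s * Real.exp (-β * s ^ 2)) := i0.add i1
  simp_rw [e]
  refine ⟨i01.add i2, ?_⟩
  rw [integral_add i01 i2, integral_add i0 i1, integral_const_mul, integral_const_mul,
    integral_const_mul, integral_mul_exp_neg_mul_sq_eq_zero hβ, integral_sq_mul_exp_neg_mul_sq hβ,
    integral_gaussian]
  field_simp; ring

/-- The radial Gaussian profile `r ↦ c r^{-(d-2)/2} exp (-b (log r)²)`. -/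
noncomputable def gaussianProfile (d : ℕ) (b c : ℝ) (r : ℝ) : ℝ :=
  c * (r ^ (-(((d : ℝ) - 2) / 2)) * Real.exp (-(b * (Real.log r) ^ 2)))

section

variable (d : ℕ) (b c : ℝ)

theorem measurable_gaussianProfile : Measurable (gaussianProfile d b c) := by
  unfold gaussianProfile
  fun_prop

theorem exp_mul_gaussianProfile (s : ℝ) :
    (Real.exp (((d : ℝ) - 2) / 2 * s) * gaussianProfile d b c (Real.exp s)) ^ 2 =
      c ^ 2 * Real.exp (-(2 * b) * s ^ 2) := by
  unfold gaussianProfile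
  rw [Real.log_exp, ← Real.exp_mul]
  have : Real.exp (((d : ℝ) - 2) / 2 * s) *
      (c * (Real.exp (s * -(((d : ℝ) - 2) / 2)) * Real.exp (-(b * s ^ 2)))) =
      c * Real.exp (-(b * s ^ 2)) := by
    rw [mul_left_comm, ← Real.exp_add, ← Real.exp_add]; congr 2; ring
  rw [this, mul_pow, ← Real.exp_nat_mul]
  congr 2; push_cast; ring

variable {d b}

theorem integral_hardy_gaussianProfile (hd : 0 < d) :
    ∫ x : EuclideanSpace ℝ (Fin d), |gaussianProfile d b c ‖x‖| ^ 2 / ‖x‖ ^ 2 =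
      sphereArea d * (c ^ 2 * √(Real.pi / (2 * b))) := by
  rw [integral_fun_norm_eq_exp hd fun r => |gaussianProfile d b c r| ^ 2 / r ^ 2]
  simp_rw [exp_mul_hardy, exp_mul_gaussianProfile]
  rw [integral_const_mul, integral_gaussian]

variable {c}

/-- In logarithmic coordinates $w^2=c^2e^{-2bs^2}$, so $\log w^2$ is quadratic in $s$; the second
moment contributes the $-1/2$. -/
theorem integral_logHardy_gaussianProfile (hd : 0 < d) (hb : 0 < b) (hc : c ≠ 0) :
    (Integrable (logHardyIntegrand fun x : EuclideanSpace ℝ (Fin d) =>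
      gaussianProfile d b c ‖x‖)) ∧
    ∫ x, logHardyIntegrand (fun x : EuclideanSpace ℝ (Fin d) => gaussianProfile d b c ‖x‖) x =
      sphereArea d * (c ^ 2 * √(Real.pi / (2 * b))) * (Real.log (c ^ 2) - 1 / 2) := by
  have h2b : 0 < 2 * b := by positivity
  have hpt : ∀ s : ℝ, Real.exp (d * s) * (|gaussianProfile d b c (Real.exp s)| ^ 2 /
      Real.exp s ^ 2 * Real.log (Real.exp s ^ ((d : ℝ) - 2) *
        |gaussianProfile d b c (Real.exp s)| ^ 2)) =
      (c ^ 2 * Real.log (c ^ 2) + 0 * s + (-(2 * b) * c ^ 2) * s ^ 2) *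
        Real.exp (-(2 * b) * s ^ 2) := fun s => by
    rw [exp_mul_logHardy, exp_mul_gaussianProfile, Real.log_mul (by positivity)
      (Real.exp_ne_zero _), Real.log_exp]
    ring
  obtain ⟨hi, he⟩ := integral_quadratic_mul_exp_neg_mul_sq h2b (c ^ 2 * Real.log (c ^ 2)) 0
    (-(2 * b) * c ^ 2)
  unfold logHardyIntegrand
  constructor
  · rw [integrable_fun_norm_iff_exp hd fun r => |gaussianProfile d b c r| ^ 2 / r ^ 2 *
      Real.log (r ^ ((d : ℝ) - 2) * |gaussianProfile d b c r| ^ 2)]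
    simp_rw [hpt]
    exact hi
  · rw [integral_fun_norm_eq_exp hd fun r => |gaussianProfile d b c r| ^ 2 / r ^ 2 *
      Real.log (r ^ ((d : ℝ) - 2) * |gaussianProfile d b c r| ^ 2)]
    simp_rw [hpt]
    rw [he]
    field_simp
    ring

/-- The radial Gaussian profile belongs to `𝒟^{1,2}`, with an explicit energy. -/
theorem exists_hasGradD12_gaussianProfile (hd : 3 ≤ d) (hb : 0 < b) :
    ∃ G, HasGradD12 (fun x : EuclideanSpace ℝ (Fin d) => gaussianProfile d b c ‖x‖) G ∧
      ∫ x, ‖G x‖ ^ 2 = sphereArea d * (c ^ 2 * √(Real.pi / (2 * b))) *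
        ((((d : ℝ) - 2) / 2) ^ 2 + b) := by
  have hd0 : 0 < d := by lia
  have hd3 : (3 : ℝ) ≤ d := by exact_mod_cast hd
  have hd2 : (0 : ℝ) < d - 2 := by linarith
  have h2b : 0 < 2 * b := by positivity
  set k : ℝ := ((d : ℝ) - 2) / 2 with hk
  set V : ℝ → ℝ := fun s => c * Real.exp (-k * s - b * s ^ 2) with hV
  set V' : ℝ → ℝ := fun s => c * (-(k + 2 * b * s) * Real.exp (-k * s - b * s ^ 2)) with hV'
  have hVs : ContDiff ℝ ∞ V := by fun_prop
  have hVd : ∀ s, HasDerivAt V (V' s) s := fun s => by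
    have h := ((((hasDerivAt_id s).const_mul (-k)).sub
      ((hasDerivAt_pow 2 s).const_mul b)).exp).const_mul c
    refine h.congr_deriv ?_
    simp only [hV', id, Pi.sub_apply]; push_cast; ring
  have hsq : ∀ s, Real.exp (((d : ℝ) - 2) * s) * Real.exp (-k * s - b * s ^ 2) ^ 2 =
      Real.exp (-(2 * b) * s ^ 2) := fun s => by
    rw [← Real.exp_nat_mul, ← Real.exp_add]; congr 1; rw [hk]; push_cast; ring
  have e2 : ∀ s, Real.exp (((d : ℝ) - 2) * s) * V s ^ 2 =
      c ^ 2 * Real.exp (-(2 * b) * s ^ 2) := fun s => by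
    rw [← hsq, hV]; ring
  have e3 : ∀ s, Real.exp (((d : ℝ) - 2) * s) * V' s ^ 2 =
      (c ^ 2 * k ^ 2 + (c ^ 2 * (4 * k * b)) * s + (c ^ 2 * (4 * b ^ 2)) * s ^ 2) *
        Real.exp (-(2 * b) * s ^ 2) := fun s => by
    rw [← hsq, hV']; ring
  obtain ⟨hi, he⟩ := integral_quadratic_mul_exp_neg_mul_sq h2b (c ^ 2 * k ^ 2)
    (c ^ 2 * (4 * k * b)) (c ^ 2 * (4 * b ^ 2))
  refine ⟨_, hasGradD12_logRadial hd hVs hVd (fun x hx => ?_) ?_ ?_ ?_, ?_⟩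
  · simp only [gaussianProfile, hV]
    rw [Real.rpow_def_of_pos (norm_pos_iff.2 hx), ← Real.exp_add]
    congr 2; rw [hk]; ring
  · set p : ℝ := 2 * (d : ℝ) / (d - 2) with hp
    have p0 : 0 < p := div_pos (by positivity) hd2
    -- At the Sobolev exponent $e^{ds}$ cancels $e^{-pks}$, leaving a pure Gaussian.
    have hpk : p * k = d := by rw [hp, hk]; field_simp
    have e1 : ∀ s, Real.exp (d * s) * |V s| ^ p = |c| ^ p * Real.exp (-(b * p) * s ^ 2) := by
      intro s
      rw [hV, abs_mul, Real.abs_exp, Real.mul_rpow (abs_nonneg _) (Real.exp_pos _).le,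
        ← Real.exp_mul, mul_left_comm, ← Real.exp_add, ← hpk]
      congr 2; ring
    simp_rw [e1]
    exact (integrable_exp_neg_mul_sq (by positivity)).const_mul _
  · simp_rw [e2]
    exact (integrable_exp_neg_mul_sq h2b).const_mul _
  · simp_rw [e3]
    exact hi
  · simp_rw [norm_div_sq_smul_self]
    rw [integral_fun_norm_eq_exp hd0 fun r => (|V' (Real.log r)| / r) ^ 2]
    have e4 : ∀ s, Real.exp (d * s) * (|V' (Real.log (Real.exp s))| / Real.exp s) ^ 2 =
        (c ^ 2 * k ^ 2 + (c ^ 2 * (4 * k * b)) * s + (c ^ 2 * (4 * b ^ 2)) * s ^ 2) *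
        Real.exp (-(2 * b) * s ^ 2) := fun s => by
      have : Real.exp (d * s) = Real.exp (((d : ℝ) - 2) * s) * Real.exp s ^ 2 := by
        rw [← Real.exp_nat_mul, ← Real.exp_add]; congr 1; push_cast; ring
      rw [← e3, Real.log_exp, div_pow, sq_abs, this]
      field_simp
    simp_rw [e4]
    rw [he]
    field_simp
    ring

end

theorem radialLogHardyExtremal_eq {d : ℕ} (hd : 3 ≤ d) :
    ∃ c : ℝ, c ≠ 0 ∧
      sphereArea d * (c ^ 2 * √(Real.pi / (2 * (((d : ℝ) - 2) ^ 2 / (4 * (d - 1)))))) = 1 ∧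
      radialLogHardyExtremal d = fun x : EuclideanSpace ℝ (Fin d) =>
        gaussianProfile d (((d : ℝ) - 2) ^ 2 / (4 * (d - 1))) c ‖x‖ := by
  have hd3 : (3 : ℝ) ≤ d := by exact_mod_cast hd
  have h1 : (0 : ℝ) < d - 1 := by linarith
  have h2 : (0 : ℝ) < d - 2 := by linarith
  have A0 := sphereArea_pos (d := d) (by lia)
  set b : ℝ := ((d : ℝ) - 2) ^ 2 / (4 * (d - 1)) with hb
  have b0 : 0 < b := by positivity
  have hprof : ∀ x, radialLogHardyProfile d x = gaussianProfile d b 1 ‖x‖ := fun x => by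
    rw [radialLogHardyProfile, gaussianProfile, one_mul]
  have hZ := integral_hardy_gaussianProfile (b := b) 1 (show 0 < d by lia)
  rw [one_pow, one_mul] at hZ
  refine ⟨(√(sphereArea d * √(Real.pi / (2 * b))))⁻¹, by positivity, ?_, ?_⟩
  · rw [inv_pow, Real.sq_sqrt (by positivity)]
    have : √(Real.pi / (2 * b)) ≠ 0 := by positivity
    field_simp
  · ext x
    rw [radialLogHardyExtremal]
    simp_rw [hprof]
    rw [hZ, gaussianProfile, gaussianProfile]
    ring

/-- The optimal value in the radial logarithmic Hardy inequality. -/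
theorem log_hardy_extremal_value {d : ℕ} (hd : 3 ≤ d) {c : ℝ}
    (hc : sphereArea d * (c ^ 2 * √(Real.pi / (2 * (((d : ℝ) - 2) ^ 2 / (4 * (d - 1)))))) = 1) :
    Real.log (c ^ 2) - 1 / 2 = (d : ℝ) / 2 * Real.log (radialLogHardyConst d *
      ((((d : ℝ) - 2) / 2) ^ 2 + ((d : ℝ) - 2) ^ 2 / (4 * (d - 1)))) := by
  have hd3 : (3 : ℝ) ≤ d := by exact_mod_cast hd
  have h0 : (0 : ℝ) < d := by linarith
  have h1 : (0 : ℝ) < d - 1 := by linarith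
  have h2 : (0 : ℝ) < d - 2 := by linarith
  have A0 := sphereArea_pos (d := d) (by lia)
  have hc2 : c ^ 2 ≠ 0 := fun h => by simp [h] at hc
  have hl := congrArg Real.log hc
  have l4 : Real.log 4 = 2 * Real.log 2 := by
    rw [show (4 : ℝ) = 2 ^ 2 by norm_num, Real.log_pow]; norm_num
  have e1 : Real.pi / (2 * (((d : ℝ) - 2) ^ 2 / (4 * (d - 1)))) =
      Real.pi * (2 * (d - 1)) / (d - 2) ^ 2 := by field_simp; ring
  have hpi := Real.pi_pos
  rw [e1] at hl
  rw [Real.log_mul A0.ne' (by positivity), Real.log_mul hc2 (by positivity),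
    Real.log_sqrt (by positivity), Real.log_div (by positivity) (by positivity),
    Real.log_mul hpi.ne' (by positivity), Real.log_mul two_ne_zero h1.ne',
    Real.log_pow ((d : ℝ) - 2) 2, Real.log_one] at hl
  -- This is the energy at which the estimates of `log_hardy_bound_le` are equalities.
  have e2 : (((d : ℝ) - 2) / 2) ^ 2 + ((d : ℝ) - 2) ^ 2 / (4 * (d - 1)) =
      (d - 2) ^ 2 * d / (4 * (d - 1)) := by field_simp; ring
  rw [e2, Real.log_mul (radialLogHardyConst_pos hd).ne' (by positivity), mul_add,
    half_mul_log_radialLogHardyConst hd, Real.log_div (by positivity) (by positivity),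
    Real.log_mul (by positivity) h0.ne', Real.log_mul (by norm_num) h1.ne',
    Real.log_pow ((d : ℝ) - 2) 2, l4]
  push_cast at hl ⊢
  linarith

theorem theoremB (d : ℕ) (hd : 3 ≤ d) :
    (∀ (u : EuclideanSpace ℝ (Fin d) → ℝ)
        (G : EuclideanSpace ℝ (Fin d) → EuclideanSpace ℝ (Fin d)),
      HasGradD12 u G → IsRadialAE u → (∫ x, |u x| ^ 2 / ‖x‖ ^ 2 = 1) →
        (∫⁻ x, ENNReal.ofReal (logHardyIntegrand u x) < ⊤) ∧
        extIntegral (logHardyIntegrand u) ≤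
          (((d : ℝ) / 2 * Real.log (radialLogHardyConst d * ∫ x, ‖G x‖ ^ 2) : ℝ) : EReal)) ∧
    (∃ G : EuclideanSpace ℝ (Fin d) → EuclideanSpace ℝ (Fin d),
      HasGradD12 (radialLogHardyExtremal d) G ∧
      IsRadialAE (radialLogHardyExtremal d) ∧
      (∫ x, |radialLogHardyExtremal d x| ^ 2 / ‖x‖ ^ 2 = 1) ∧
      Integrable (logHardyIntegrand (radialLogHardyExtremal d)) ∧
      ∫ x, logHardyIntegrand (radialLogHardyExtremal d) x =
        (d : ℝ) / 2 * Real.log (radialLogHardyConst d * ∫ x, ‖G x‖ ^ 2)) := by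
  refine ⟨fun u G h hr h1 => radial_log_hardy hd h hr h1, ?_⟩
  have hd0 : 0 < d := by lia
  have hd3 : (3 : ℝ) ≤ d := by exact_mod_cast hd
  have hb : 0 < ((d : ℝ) - 2) ^ 2 / (4 * (d - 1)) :=
    div_pos (pow_pos (by linarith) 2) (by linarith)
  obtain ⟨c, hc0, hc, hu⟩ := radialLogHardyExtremal_eq hd
  obtain ⟨G, hG, hGe⟩ := exists_hasGradD12_gaussianProfile (c := c) hd hb
  obtain ⟨hi, he⟩ := integral_logHardy_gaussianProfile hd0 hb hc0
  rw [hu]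
  refine ⟨G, hG, ⟨_, measurable_gaussianProfile d _ c, Eventually.of_forall fun x => rfl⟩,
    ?_, hi, ?_⟩
  · rw [integral_hardy_gaussianProfile c hd0, hc]
  · rw [he, hGe, hc, one_mul, one_mul]
    exact log_hardy_extremal_value hd hc
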